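/- For an integer $k$ let $M_k = T_k\cup C\subset S^3$ be the two-component link with the following diagram. Two horizontal strands, a top one and a bottom one, run from left to right through a round circle $C$, which passes over both strands on its left side and under both strands on its right side. To the right of $C$ the two strands are twisted about each other by $|k|$ half-twists (right-handed if $k>0$, left-handed if $k<0$, none if $k=0$). The two left ends and the two right ends are then led downwards, the ends of the top strand on the outside, to a clasp, which consists of two crossings one above the other; at both crossings of the clasp the over-strand runs from south-west to north-east. The two strands and the clasp form one component, the twist knot $T_k$. Orient $M_k$ arbitrarily. A quandle is a set with operations $x\rhd y=x^y$ and $x\rhd^{-1}y=x^{\bar y}$ such that $x\rhd x=x$, $(x\rhd y)\rhd^{-1}y=x=(x\rhd^{-1}y)\rhd y$ and $(x\rhd y)\rhd z=(x\rhd z)\rhd(y\rhd z)$; its components are the orbits of the group generated by the maps $x\mapsto x\rhd y$. The fundamental quandle of an oriented link is generated by the arcs of a diagram, with one relation $x_i=x_k^{x_j}$ for each crossing, where $x_j$ is the over-arc, $x_k$ the under-arc on its right and $x_i$ the under-arc on its left. Let $Q_{(2,3)}(M_k)$ be the fundamental $(2,3)$-quandle of $M_k$, that is, the quotient of the fundamental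 quandle by the relations $(x\rhd y)\rhd y=x$ for all arcs $x$ of $M_k$ and $y$ of $T_k$, and $((x\rhd y)\rhd y)\rhd y=x$ for all arcs $x$ of $M_k$ and $y$ of $C$. Then $$|Q_{(2,3)}(M_k)| = 18\,|2k-1|+8 .$$ More precisely, the component of $Q_{(2,3)}(M_k)$ that contains the arcs of $T_k$ has $18\,|2k-1|$ elements, and the component that contains the arcs of $C$ has $8$ elements. -/

import Mathlib

/-! ### Quandles given by a presentation -/

/-- Terms in the quandle operations `x ▷ y` (`rhd x y`) and `x ▷⁻¹ y` (`rhdInv x y`)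
over a set `X` of generators. -/
inductive QTerm (X : Type) : Type
  | of (x : X) : QTerm X
  | rhd (s t : QTerm X) : QTerm X
  | rhdInv (s t : QTerm X) : QTerm X

/-- The congruence on quandle terms generated by the quandle axioms and the relations `R`. -/
inductive QTerm.Rel {X : Type} (R : QTerm X → QTerm X → Prop) : QTerm X → QTerm X → Prop
  | of {s t} : R s t → Rel R s t
  | refl (s) : Rel R s s
  | symm {s t} : Rel R s t → Rel R t s
  | trans {s t u} : Rel R s t → Rel R t u → Rel R s u
  | rhd_congr {s s' t t'} : Rel R s s' → Rel R t t' → Rel R (rhd s t) (rhd s' t')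
  | rhdInv_congr {s s' t t'} : Rel R s s' → Rel R t t' → Rel R (rhdInv s t) (rhdInv s' t')
  | idem (s) : Rel R (rhd s s) s
  | rhd_rhdInv (s t) : Rel R (rhdInv (rhd s t) t) s
  | rhdInv_rhd (s t) : Rel R (rhd (rhdInv s t) t) s
  | distrib (s t u) : Rel R (rhd (rhd s t) u) (rhd (rhd s u) (rhd t u))

def QTerm.setoid {X : Type} (R : QTerm X → QTerm X → Prop) : Setoid (QTerm X) where
  r := QTerm.Rel R
  iseqv := ⟨QTerm.Rel.refl, QTerm.Rel.symm, QTerm.Rel.trans⟩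

/-- The quandle `⟨X | R⟩`. -/
def PresentedQuandle {X : Type} (R : QTerm X → QTerm X → Prop) : Type :=
  Quotient (QTerm.setoid R)

/-- The class of a term in `⟨X | R⟩`. -/
def PresentedQuandle.mk {X : Type} (R : QTerm X → QTerm X → Prop) (s : QTerm X) :
    PresentedQuandle R :=
  Quotient.mk (QTerm.setoid R) s

/-- Mathlib writes the operator on the left: `y ◃ x` is `x ▷ y`, that is `x ^ y` in exponential
notation. -/
instance {X : Type} (R : QTerm X → QTerm X → Prop) : Quandle (PresentedQuandle R) where
  act y x := Quotient.map₂ (sa := QTerm.setoid R) (sb := QTerm.setoid R) (sc := QTerm.setoid R)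
    QTerm.rhd (fun _ _ h _ _ h' => QTerm.Rel.rhd_congr h h') x y
  invAct y x := Quotient.map₂ (sa := QTerm.setoid R) (sb := QTerm.setoid R) (sc := QTerm.setoid R)
    QTerm.rhdInv (fun _ _ h _ _ h' => QTerm.Rel.rhdInv_congr h h') x y
  self_distrib := by
    rintro ⟨x⟩ ⟨y⟩ ⟨z⟩
    exact Quotient.sound (QTerm.Rel.distrib z y x)
  left_inv := by
    rintro ⟨y⟩ ⟨x⟩
    exact Quotient.sound (QTerm.Rel.rhd_rhdInv x y)
  right_inv := by
    rintro ⟨y⟩ ⟨x⟩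
    exact Quotient.sound (QTerm.Rel.rhdInv_rhd x y)
  fix := by
    rintro ⟨x⟩
    exact Quotient.sound (QTerm.Rel.idem x)

/-- The inner automorphism group: generated by the point symmetries `x ↦ x ▷ y`. -/
def innerGroup (Q : Type) [Quandle Q] : Subgroup (Equiv.Perm Q) :=
  Subgroup.closure (Set.range fun y : Q => Rack.act' y)

/-- The (algebraic) component of `x`: its orbit under the inner automorphism group. -/
def quandleComponent {Q : Type} [Quandle Q] (x : Q) : Set Q :=
  MulAction.orbit (innerGroup Q) x

/-! ### Link diagrams -/

/-- A planar-diagram code. Each crossing has four ends, numbered `0, 1, 2, 3` counterclockwise;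
the ends `i` and `i + 2` belong to the same strand through the crossing. Every edge of the diagram
joins two of these ends. -/
structure PDCode where
  Crossing : Type
  Edge : Type
  /-- the edge attached at the given end of a crossing -/
  edge : Crossing × Fin 4 → Edge
  /-- `true` if the strand through the ends `0, 2` is the over-strand, `false` if the strand
  through the ends `1, 3` is -/
  overEven : Crossing → Bool
  finite : Finite Crossing
  two_ends : ∀ e, ∃ x y, x ≠ y ∧ ∀ z, edge z = e ↔ z = x ∨ z = y

namespace PDCode

/-- The end `i` of the crossing `c` belongs to the over-strand. -/
def IsOver (D : PDCode) (c : D.Crossing) (i : Fin 4) : Prop :=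
  i.val % 2 = 0 ↔ D.overEven c = true

/-- Two edges are consecutive on a strand through a crossing. -/
def Consecutive (D : PDCode) (e f : D.Edge) : Prop :=
  ∃ c i, D.edge (c, i) = e ∧ D.edge (c, i + 2) = f

/-- Two crossings are joined by an edge. -/
def Joined (D : PDCode) (c c' : D.Crossing) : Prop :=
  ∃ i j, D.edge (c, i) = D.edge (c', j)

/-- A pair `(c, i)` also stands for the sector at `c` between the ends `i` and `i + 1`. Two
sectors are neighbours if they lie at the two ends of an edge, on the same side of it; the faces
of the diagram are the classes of the equivalence relation that this generates. -/
def SameSide (D : PDCode) (x y : D.Crossing × Fin 4) : Prop :=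
  (x.1, x.2 + 1) ≠ y ∧ D.edge (x.1, x.2 + 1) = D.edge y

end PDCode

/-- A connected diagram on the sphere of a link with `r` ordered components. As the number of
edges is twice the number of crossings, `planar` is Euler's formula for genus zero. -/
structure LinkDiagram (r : ℕ) extends PDCode where
  connected : ∀ c c', Relation.EqvGen toPDCode.Joined c c'
  planar : Nat.card (Quot toPDCode.SameSide) = Nat.card Crossing + 2
  /-- the link component on which an edge lies -/
  comp : Edge → Fin r
  comp_surjective : Function.Surjective comp
  comp_eq_iff : ∀ e f, comp e = comp f ↔ Relation.EqvGen toPDCode.Consecutive e f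

namespace LinkDiagram

/-- An orientation of the link: `out (c, i) = true` if the edge at the end `i` of the crossing `c`
is directed away from `c` there. -/
structure Orientation {r : ℕ} (D : LinkDiagram r) where
  out : D.Crossing × Fin 4 → Bool
  through : ∀ c i, out (c, i + 2) = !out (c, i)
  along : ∀ x y, x ≠ y → D.edge x = D.edge y → out y = !out x

/-- The Wirtinger relations: the two edges of an over-strand are parts of one arc, and
`z = x ▷ y` where `y` is the over-strand, `x` the under-edge on its right and `z` the
under-edge on its left (as seen along the direction of `y`). -/
inductive WirtingerRel {r : ℕ} (D : LinkDiagram r) (o : D.Orientation) :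
    QTerm D.Edge → QTerm D.Edge → Prop
  | over (c i) (h : D.IsOver c i) :
      WirtingerRel D o (.of (D.edge (c, i))) (.of (D.edge (c, i + 2)))
  | under (c i) (h : D.IsOver c i) (h' : o.out (c, i) = true) :
      WirtingerRel D o (.of (D.edge (c, i + 1)))
        (.rhd (.of (D.edge (c, i + 3))) (.of (D.edge (c, i))))

/-- The Wirtinger relations, together with `x ^ (y ^ n) = x` for all generators `x` and `y`,
where `n = N i` if `y` lies on the `i`-th component of the link. -/
inductive NWirtingerRel {r : ℕ} (D : LinkDiagram r) (o : D.Orientation) (N : Fin r → ℕ) :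
    QTerm D.Edge → QTerm D.Edge → Prop
  | wirtinger {s t} (h : WirtingerRel D o s t) : NWirtingerRel D o N s t
  | power (x y : D.Edge) :
      NWirtingerRel D o N ((fun s => QTerm.rhd s (.of y))^[N (D.comp y)] (.of x)) (.of x)

/-- The fundamental `N`-quandle of the oriented link. -/
abbrev NQuandle {r : ℕ} (D : LinkDiagram r) (o : D.Orientation) (N : Fin r → ℕ) : Type :=
  PresentedQuandle (NWirtingerRel D o N)

/-- The element of the fundamental `N`-quandle given by an edge (a part of an arc). -/
def arc {r : ℕ} (D : LinkDiagram r) (o : D.Orientation) (N : Fin r → ℕ) (e : D.Edge) :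
    D.NQuandle o N :=
  PresentedQuandle.mk _ (.of e)

end LinkDiagram

/-! ### The links `M_k = T_k ∪ C`

Two horizontal strands, top and bottom, pass from left to right through the circle `C` and then
through a block of `|k|` half-twists about a horizontal axis. Outside of this block the two left
ends and the two right ends are led downwards, the top ends outermost, to a clasp. The clasp
consists of two crossings one above the other (a full twist about a vertical axis). -/

namespace TwistLink

/-- `topL`, `botL` (`topR`, `botR`) are the crossings of the left (right) half of `C` with the top
and bottom strand, `twist i` is the `i`-th half-twist from the left, and `claspTop`, `claspBot`
are the upper and the lower crossing of the clasp. -/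
inductive Crossing (m : ℕ) : Type
  | topL | botL | topR | botR | claspTop | claspBot
  | twist (i : Fin m)

/-- `a`, `b`: from the left end of the top and bottom strand to the clasp. `topIn`, `botIn`: the
parts of the two strands inside `C`. `top j`, `bot j`: the parts of the two strands to the right of
`j` half-twists (for `j = m` up to the clasp). `cN`, `cW`, `cS`, `cE`: the four edges of `C`.
`claspL`, `claspR`: the two edges between the crossings of the clasp. -/
inductive Edge (m : ℕ) : Type
  | a | b | topIn | botIn | cN | cW | cS | cE | claspL | claspR
  | top (j : Fin (m + 1))
  | bot (j : Fin (m + 1))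

/-- The edges at a crossing, in the order west, south, east, north for the crossings with `C`, and
in the order north-west, south-west, south-east, north-east for the others. -/
def ends {m : ℕ} : Crossing m → Fin 4 → Edge m
  | .topL => ![.a, .cW, .topIn, .cN]
  | .botL => ![.b, .cS, .botIn, .cW]
  | .topR => ![.topIn, .cE, .top 0, .cN]
  | .botR => ![.botIn, .cS, .bot 0, .cE]
  | .twist i => ![.top i.castSucc, .bot i.castSucc, .bot i.succ, .top i.succ]
  | .claspTop => ![.b, .claspL, .claspR, .bot (Fin.last m)]
  | .claspBot => ![.claspL, .a, .top (Fin.last m), .claspR]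

/-- The left half of `C` is over, the right half under the two strands. In the clasp the strand
from south-west to north-east is over at both crossings. The half-twists are right-handed (the
strand from north-west to south-east is over) if `right = true`, and left-handed otherwise. -/
def overEven {m : ℕ} (right : Bool) : Crossing m → Bool
  | .topL => false
  | .botL => false
  | .topR => true
  | .botR => true
  | .twist _ => right
  | .claspTop => false
  | .claspBot => false

/-- The link component of an edge: `0` is the twist knot, `1` is `C`. -/
def comp {m : ℕ} : Edge m → Fin 2
  | .cN => 1
  | .cW => 1
  | .cS => 1
  | .cE => 1
  | _ => 0

theorem crossing_equiv (m : ℕ) : Nonempty (Crossing m ≃ Fin 6 ⊕ Fin m) :=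
  ⟨{ toFun := fun c => match c with
      | .topL => .inl 0 | .botL => .inl 1 | .topR => .inl 2 | .botR => .inl 3
      | .claspTop => .inl 4 | .claspBot => .inl 5 | .twist i => .inr i
     invFun := fun x => match x with
      | .inl 0 => .topL | .inl 1 => .botL | .inl 2 => .topR | .inl 3 => .botR
      | .inl 4 => .claspTop | .inl 5 => .claspBot | .inr i => .twist i
     left_inv := by intro c; cases c <;> rfl
     right_inv := by
      rintro (i | i)
      · fin_cases i <;> rfl
      · rfl }⟩

/-- Distinguishes the two ends of an edge. -/
def side {m : ℕ} : Crossing m → Fin 4 → Bool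
  | .topL => ![true, true, true, true]
  | .botL => ![true, true, true, false]
  | .topR => ![false, true, true, false]
  | .botR => ![false, false, true, false]
  | .twist _ => ![false, false, true, true]
  | .claspTop => ![false, true, true, false]
  | .claspBot => ![false, false, false, false]

/-- The end of an edge on the given side. -/
def endOf {m : ℕ} : Edge m → Bool → Crossing m × Fin 4
  | .a, s => if s then (.topL, 0) else (.claspBot, 1)
  | .b, s => if s then (.botL, 0) else (.claspTop, 0)
  | .topIn, s => if s then (.topL, 2) else (.topR, 0)
  | .botIn, s => if s then (.botL, 2) else (.botR, 0)
  | .cN, s => if s then (.topL, 3) else (.topR, 3)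
  | .cW, s => if s then (.topL, 1) else (.botL, 3)
  | .cS, s => if s then (.botL, 1) else (.botR, 1)
  | .cE, s => if s then (.topR, 1) else (.botR, 3)
  | .claspL, s => if s then (.claspTop, 1) else (.claspBot, 0)
  | .claspR, s => if s then (.claspTop, 2) else (.claspBot, 3)
  | .top j, true => Fin.cases (.topR, 2) (fun i => (.twist i, 3)) j
  | .top j, false => Fin.lastCases (.claspBot, 2) (fun i => (.twist i, 0)) j
  | .bot j, true => Fin.cases (.botR, 2) (fun i => (.twist i, 2)) j
  | .bot j, false => Fin.lastCases (.claspTop, 3) (fun i => (.twist i, 1)) j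

theorem endOf_ends {m : ℕ} (c : Crossing m) (i : Fin 4) :
    endOf (ends c i) (side c i) = (c, i) := by
  cases c <;> fin_cases i <;> simp [ends, side, endOf]

theorem ends_endOf {m : ℕ} (e : Edge m) (s : Bool) :
    ends (endOf e s).1 (endOf e s).2 = e ∧ side (endOf e s).1 (endOf e s).2 = s := by
  cases e with
  | top j =>
    cases s
    · cases j using Fin.lastCases <;> simp [ends, side, endOf]
    · cases j using Fin.cases <;> simp [ends, side, endOf]
  | bot j =>
    cases s
    · cases j using Fin.lastCases <;> simp [ends, side, endOf]
    · cases j using Fin.cases <;> simp [ends, side, endOf]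
  | _ => cases s <;> simp [ends, side, endOf]

theorem two_ends {m : ℕ} (e : Edge m) : ∃ x y : Crossing m × Fin 4,
    x ≠ y ∧ ∀ z : Crossing m × Fin 4, ends z.1 z.2 = e ↔ z = x ∨ z = y := by
  refine ⟨endOf e true, endOf e false, fun h => ?_, fun z => ⟨?_, ?_⟩⟩
  · have h1 := (ends_endOf e true).2
    rw [h, (ends_endOf e false).2] at h1
    simp at h1
  · rintro rfl
    rcases hs : side z.1 z.2
    · exact .inr (by rw [← hs, endOf_ends])
    · exact .inl (by rw [← hs, endOf_ends])
  · rintro (rfl | rfl)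
    · exact (ends_endOf e _).1
    · exact (ends_endOf e _).1

theorem side_ne {m : ℕ} {c c' : Crossing m} {i j : Fin 4} (h : (c, i) ≠ (c', j))
    (h' : ends c i = ends c' j) : side c' j = !side c i := by
  by_contra hs
  have hs' : side c i = side c' j := by
    revert hs
    cases side c' j <;> cases side c i <;> simp
  exact h (by rw [← endOf_ends c i, ← endOf_ends c' j, h', hs'])

/-- The planar-diagram code of the diagram with `|k|` half-twists, right-handed for `k > 0` and
left-handed for `k < 0`. -/
def code (k : ℤ) : PDCode where
  Crossing := Crossing k.natAbs
  Edge := Edge k.natAbs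
  edge x := ends x.1 x.2
  overEven := overEven (decide (0 < k))
  finite := (crossing_equiv _).elim fun e => Finite.of_equiv _ e.symm
  two_ends := two_ends

theorem connected (k : ℤ) (c c' : (code k).Crossing) :
    Relation.EqvGen (code k).Joined c c' := by
  have step : ∀ (c c' : Crossing k.natAbs) (i j), ends c i = ends c' j →
      Relation.EqvGen (code k).Joined c c' := fun c c' i j h => .rel _ _ ⟨i, j, h⟩
  suffices H : ∀ c : Crossing k.natAbs, Relation.EqvGen (code k).Joined c .topR from
    (H c).trans _ _ _ ((H c').symm _ _)
  have hL : Relation.EqvGen (code k).Joined .topL .topR := step _ _ 2 0 rfl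
  have hB : Relation.EqvGen (code k).Joined .claspBot .topR := (step _ .topL 1 0 rfl).trans _ _ _ hL
  intro c
  cases c with
  | topL => exact hL
  | botL => exact (step _ .topL 3 1 rfl).trans _ _ _ hL
  | topR => exact .refl _
  | botR => exact step _ _ 3 1 rfl
  | claspTop => exact (step _ .claspBot 1 0 rfl).trans _ _ _ hB
  | claspBot => exact hB
  | twist i =>
    obtain ⟨n, hn⟩ := i
    induction n with
    | zero => exact step _ _ 0 2 rfl
    | succ n ih => exact (step _ (.twist ⟨n, by omega⟩) 0 3 rfl).trans _ _ _ (ih (by omega))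

theorem comp_eq_iff (k : ℤ) (e f : (code k).Edge) :
    comp e = comp f ↔ Relation.EqvGen (code k).Consecutive e f := by
  have step : ∀ (c : Crossing k.natAbs) (i : Fin 4),
      Relation.EqvGen (code k).Consecutive (ends c i) (ends c (i + 2)) :=
    fun c i => .rel _ _ ⟨c, i, rfl, rfl⟩
  constructor
  · have hb : Relation.EqvGen (code k).Consecutive .b .a :=
      (step .claspTop 0).trans _ _ _ (step .claspBot 3)
    have ht0 : Relation.EqvGen (code k).Consecutive (.top 0) .a :=
      (step .topR 2).trans _ _ _ (step .topL 2)
    have hb0 : Relation.EqvGen (code k).Consecutive (.bot 0) .a :=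
      ((step .botR 2).trans _ _ _ (step .botL 2)).trans _ _ _ hb
    have htb : ∀ n (hn : n < k.natAbs + 1),
        Relation.EqvGen (code k).Consecutive (.top ⟨n, hn⟩) .a ∧
        Relation.EqvGen (code k).Consecutive (.bot ⟨n, hn⟩) .a := by
      intro n
      induction n with
      | zero => exact fun _ => ⟨ht0, hb0⟩
      | succ n ih =>
        intro hn
        have := ih (by omega)
        exact ⟨(step (.twist ⟨n, by omega⟩) 3).trans _ _ _ this.2,
          (step (.twist ⟨n, by omega⟩) 2).trans _ _ _ this.1⟩
    have h0 : ∀ e : Edge k.natAbs, comp e = 0 → Relation.EqvGen (code k).Consecutive e .a := by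
      intro e he
      cases e with
      | a => exact .refl _
      | b => exact hb
      | topIn => exact step .topL 2
      | botIn => exact (step .botL 2).trans _ _ _ hb
      | claspL => exact (step .claspTop 1).trans _ _ _ (htb _ (Nat.lt_succ_self _)).2
      | claspR => exact step .claspBot 3
      | top j => exact (htb j.1 j.2).1
      | bot j => exact (htb j.1 j.2).2
      | cN => simp [comp] at he
      | cW => simp [comp] at he
      | cS => simp [comp] at he
      | cE => simp [comp] at he
    have h1 : ∀ e : Edge k.natAbs, comp e = 1 → Relation.EqvGen (code k).Consecutive e .cN := by
      intro e he
      cases e with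
      | cN => exact .refl _
      | cW => exact step .topL 1
      | cS => exact (step .botL 1).trans _ _ _ (step .topL 1)
      | cE => exact step .topR 1
      | _ => simp [comp] at he
    intro h
    rcases (show ∀ x : Fin 2, x = 0 ∨ x = 1 by decide) (comp e) with he | he
    · exact (h0 e he).trans _ _ _ ((h0 f (h ▸ he)).symm _ _)
    · exact (h1 e he).trans _ _ _ ((h1 f (h ▸ he)).symm _ _)
  · intro h
    induction h with
    | rel x y h =>
      obtain ⟨c, i, rfl, rfl⟩ := h
      cases c <;> fin_cases i <;> rfl
    | refl => rfl
    | symm _ _ _ ih => exact ih.symm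
    | trans _ _ _ _ _ ih ih' => exact ih.trans ih'

/-- The face to which a sector belongs: `.inr j` lies between the edges `top j` and `bot j`. -/
def face {m : ℕ} : Crossing m → Fin 4 → Fin 7 ⊕ Fin (m + 1)
  | .topL => ![.inl 0, .inl 1, .inl 2, .inl 3]
  | .botL => ![.inl 4, .inl 5, .inl 1, .inl 0]
  | .topR => ![.inl 1, .inr 0, .inl 3, .inl 2]
  | .botR => ![.inl 5, .inl 4, .inr 0, .inl 1]
  | .twist i => ![.inr i.castSucc, .inl 4, .inr i.succ, .inl 3]
  | .claspTop => ![.inl 0, .inl 6, .inr (Fin.last m), .inl 4]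
  | .claspBot => ![.inl 0, .inl 3, .inr (Fin.last m), .inl 6]

/-- The face on the counterclockwise side of the end of `e` on the side `s`. -/
def edgeFace {m : ℕ} : Edge m → Bool → Fin 7 ⊕ Fin (m + 1)
  | .a, s => .inl (if s then 0 else 3)
  | .b, s => .inl (if s then 4 else 0)
  | .topIn, s => .inl (if s then 2 else 1)
  | .botIn, s => .inl (if s then 1 else 5)
  | .cN, s => .inl (if s then 3 else 2)
  | .cW, s => .inl (if s then 1 else 0)
  | .cS, s => .inl (if s then 5 else 4)
  | .cE, s => if s then .inr 0 else .inl 1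
  | .claspL, s => .inl (if s then 6 else 0)
  | .claspR, s => if s then .inr (Fin.last m) else .inl 6
  | .top j, s => if s then .inl 3 else .inr j
  | .bot j, s => if s then .inr j else .inl 4

theorem face_eq {m : ℕ} (c : Crossing m) (i : Fin 4) :
    face c i = edgeFace (ends c i) (side c i) := by
  cases c <;> fin_cases i <;> rfl

theorem face_eq' {m : ℕ} (c : Crossing m) (i : Fin 4) :
    face c i = edgeFace (ends c (i + 1)) (!side c (i + 1)) := by
  cases c <;> fin_cases i <;> rfl

/-- A sector of each face. -/
def sector {m : ℕ} : Fin 7 ⊕ Fin (m + 1) → Crossing m × Fin 4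
  | .inl i => ![(.topL, 0), (.topL, 1), (.topL, 2), (.topR, 2), (.botR, 1), (.botL, 1),
      (.claspTop, 1)] i
  | .inr j => endOf (.top j) false

theorem planar (k : ℤ) : Nat.card (Quot (code k).SameSide) = Nat.card (code k).Crossing + 2 := by
  have hc : Nat.card (code k).Crossing = 6 + k.natAbs := by
    obtain ⟨e⟩ := crossing_equiv k.natAbs
    exact (Nat.card_congr e).trans (by simp)
  let q : Crossing k.natAbs → Fin 4 → Quot (code k).SameSide := fun c i => Quot.mk _ (c, i)
  have wd : ∀ x y : Crossing k.natAbs × Fin 4, (code k).SameSide x y →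
      face x.1 x.2 = face y.1 y.2 := by
    rintro ⟨c, i⟩ ⟨c', j⟩ ⟨h, h'⟩
    change ends c (i + 1) = ends c' j at h'
    rw [face_eq', face_eq, ← side_ne h h', h']
  have step : ∀ (c : Crossing k.natAbs) (i : Fin 4),
      q c i = Quot.mk _ (endOf (ends c (i + 1)) (!side c (i + 1))) := by
    intro c i
    have h := ends_endOf (ends c (i + 1)) (!side c (i + 1))
    refine Quot.sound ⟨fun h' => ?_, h.1.symm⟩
    have h2 := h.2
    rw [← h'] at h2
    simp at h2
  have htop : ∀ j, Quot.mk (code k).SameSide (endOf (.top j) true) = q .topR 2 := by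
    intro j
    induction j using Fin.induction with
    | zero => rfl
    | succ i ih => exact (step (.twist i) 3).trans ih
  have hbot : ∀ j, Quot.mk (code k).SameSide (endOf (.bot j) false) = q .botR 1 := by
    intro j
    induction j using Fin.induction with
    | zero => exact (step .botR 1).symm
    | succ i ih =>
      refine (step (.twist i) 1).symm.trans (Eq.trans ?_ ih)
      simp [q, endOf]
      rfl
  have hb3 : q .claspTop 3 = q .botR 1 := by
    rw [← hbot (Fin.last _)]
    simp [q, endOf]
    rfl
  have hl : q .claspBot 2 = Quot.mk _ (endOf (.top (Fin.last _)) false) := by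
    simp [q, endOf]
    rfl
  have e : Quot (code k).SameSide ≃ Fin 7 ⊕ Fin (k.natAbs + 1) :=
    { toFun := Quot.lift (fun x => face x.1 x.2) wd
      invFun := fun f => Quot.mk _ (sector f)
      left_inv := by
        rintro ⟨c, i⟩
        change Quot.mk _ (sector (face c i)) = q c i
        symm
        have b3 : q .botL 3 = q .topL 0 := (step .topL 0).symm
        have c0 : q .claspTop 0 = q .topL 0 := (step .botL 3).symm.trans b3
        have t0 : q .topR 0 = q .topL 1 := (step .topL 1).symm
        have r3 : q .botR 3 = q .topL 1 := (step .topR 0).symm.trans t0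
        cases c with
        | topL =>
          fin_cases i
          · rfl
          · rfl
          · rfl
          · exact (step .topR 2).symm
        | botL =>
          fin_cases i
          · exact step .botL 0
          · rfl
          · exact step .botL 2
          · exact b3
        | topR =>
          fin_cases i
          · exact t0
          · exact step .topR 1
          · rfl
          · exact step .topR 3
        | botR =>
          fin_cases i
          · exact (step .botL 1).symm
          · rfl
          · exact (step .botR 2).trans (step .topR 1)
          · exact r3
        | claspTop =>
          fin_cases i
          · exact c0
          · rfl
          · exact (step .claspBot 2).symm.trans hl
          · exact hb3
        | claspBot =>
          fin_cases i
          · exact (step .claspTop 0).symm.trans c0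
          · exact (step .claspBot 1).trans (htop _)
          · exact hl
          · exact (step .claspTop 1).symm
        | twist i' =>
          fin_cases i
          · simp [q, face, sector, endOf]
            rfl
          · exact (congrArg (Quot.mk _) (by simp [endOf]; rfl)).trans (hbot i'.castSucc)
          · exact step (.twist i') 2
          · exact htop i'.succ
      right_inv := by
        rintro (i | j)
        · fin_cases i <;> rfl
        · change face (endOf (.top j) false).1 (endOf (.top j) false).2 = _
          rw [face_eq, (ends_endOf _ _).1, (ends_endOf _ _).2]
          rfl }
  rw [hc, Nat.card_congr e]
  simp
  omega

/-- An orientation: `true` if the edge is directed from its end on the side `true` to the other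
one. -/
def direction {m : ℕ} : Edge m → Bool
  | .a => true
  | .b => false
  | .topIn => false
  | .botIn => true
  | .cN => false
  | .cW => true
  | .cS => true
  | .cE => false
  | .claspL => decide (m % 2 = 0)
  | .claspR => false
  | .top j => decide (j.val % 2 = 1)
  | .bot j => decide (j.val % 2 = 0)

end TwistLink

/-- The link `M_k = T_k ∪ C` for an integer `k`, with the twist knot `T_k` as its first and `C` as
its second component. -/
def twistLink (k : ℤ) : LinkDiagram 2 where
  toPDCode := TwistLink.code k
  connected := TwistLink.connected k
  planar := TwistLink.planar k
  comp := TwistLink.comp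
  comp_surjective := by
    intro i
    fin_cases i
    · exact ⟨TwistLink.Edge.a, rfl⟩
    · exact ⟨TwistLink.Edge.cN, rfl⟩
  comp_eq_iff := TwistLink.comp_eq_iff k

theorem twistLink_orientation_nonempty (k : ℤ) : Nonempty (twistLink k).Orientation := by
  refine ⟨⟨fun x => !xor (TwistLink.side x.1 x.2) (TwistLink.direction (TwistLink.ends x.1 x.2)),
    ?_, ?_⟩⟩
  · intro c i
    rcases c with _ | _ | _ | _ | _ | _ | j <;> fin_cases i <;>
      simp [TwistLink.side, TwistLink.ends, TwistLink.direction] <;> grind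
  · rintro ⟨c, i⟩ ⟨c', j⟩ h h'
    change TwistLink.ends c i = TwistLink.ends c' j at h'
    have := TwistLink.side_ne h h'
    simp [this, h']

/-!
The block of half-twists lies in the dihedral subquandle generated by the strands `x` and `y` inside
the circle. Number its elements `d s` so that `x = d 0`, `y = d 1` and `d i ◃ d j = d (2 * i - j)`;
a half-twist then only shifts the numbers. Let `Z`, of order three, be the symmetry at `C` or its
inverse and let `m = 2 * k - 1`. The clasp says that the symmetries at `Z x` and `Z⁻¹ x` act on the
sequence `d` as the reflections `s ↦ -m - s` and `s ↦ m - s`. Comparing the two orders in which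
these can be multiplied gives `d (s + 6 * m) = d s`. So the elements `Z ^ i (d s)`, at most
`3 * 6 * |m|` of them, make up the component of `T_k`. The symmetries at `x`, `Z x` and `Z⁻¹ x`
commute on the fixed points of the rotation `d s ↦ d (s + 2)`. As the arc `c` of `C` is one of
these, its component has at most `2 ^ 3` elements.

No further identifications take place, because two conjugation representations separate these
elements. In `SL(2, 3)`, with the arcs of `T_k` of order four and those of `C` of order three, one
reads off `i` modulo `3` and `s` modulo `2`; in the dihedral group of order `6 * |m|`, with
reflections for the arcs of `T_k` and a rotation of order three for `C`, one reads off `s` modulo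
`3 * m`.
-/

open Quandles

/-! ### Inner automorphisms and presentations -/

theorem semiconj_zpow {α β : Type*} {f : α → β} {p : Equiv.Perm α} {q : Equiv.Perm β}
    (h : Function.Semiconj f p q) (n : ℤ) : Function.Semiconj f ⇑(p ^ n) ⇑(q ^ n) := by
  have pow : ∀ n : ℕ, Function.Semiconj f ⇑(p ^ n) ⇑(q ^ n) := fun n => by
    simpa only [Equiv.Perm.coe_pow] using h.iterate_right n
  obtain ⟨n, rfl | rfl⟩ := n.eq_nat_or_neg
  · simpa only [zpow_natCast] using pow n
  · rw [zpow_neg, zpow_neg, zpow_natCast, zpow_natCast]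
    exact (pow n).inverses_right (p ^ n).right_inv (q ^ n).left_inv

theorem mapsTo_of_mem_closure {α : Type*} {S : Set (Equiv.Perm α)} {K : Set α}
    (hS : ∀ p ∈ S, IsOfFinOrder p) (hK : ∀ p ∈ S, Set.MapsTo p K K) {p : Equiv.Perm α}
    (hp : p ∈ Subgroup.closure S) : Set.MapsTo p K K := by
  rw [← Subgroup.mem_toSubmonoid, Subgroup.closure_toSubmonoid_of_isOfFinOrder hS] at hp
  induction hp using Submonoid.closure_induction with
  | mem p hp => exact hK p hp
  | one => exact Set.mapsTo_id K
  | mul p q _ _ hp hq => exact hp.comp hq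

theorem natCard_range_eq_of_apply_eq_iff {α β γ : Type*} {f : α → β} {g : α → γ}
    (h : ∀ a b, f a = f b ↔ g a = g b) : Nat.card (Set.range f) = Nat.card (Set.range g) := by
  have ker_eq : Setoid.ker f = Setoid.ker g := Setoid.ext h
  exact Nat.card_congr <| (Setoid.quotientKerEquivRange f).symm.trans <|
    (Quotient.congrRight (Setoid.ext_iff.1 ker_eq)).trans (Setoid.quotientKerEquivRange g)

section InnerGroup

variable {Q : Type} [Quandle Q]

theorem act'_mem_innerGroup (y : Q) : Rack.act' y ∈ innerGroup Q :=
  Subgroup.subset_closure ⟨y, rfl⟩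

theorem act'_apply_of_mem_innerGroup {p : Equiv.Perm Q} (hp : p ∈ innerGroup Q) (x : Q) :
    Rack.act' (p x) = p * Rack.act' x * p⁻¹ := by
  induction hp using Subgroup.closure_induction generalizing x with
  | mem p hp =>
    obtain ⟨y, rfl⟩ := hp
    exact Rack.ad_conj y x
  | one => simp
  | mul p q _ _ hp hq => simp only [Equiv.Perm.mul_apply, hp, hq, mul_inv_rev, mul_assoc]
  | inv p _ hp =>
    have conj := hp (p⁻¹ x)
    rw [← Equiv.Perm.mul_apply, mul_inv_cancel, Equiv.Perm.one_apply] at conj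
    rw [conj]
    group

theorem act'_apply_pow_eq_one {p : Equiv.Perm Q} (hp : p ∈ innerGroup Q) {x : Q} {n : ℕ}
    (hx : Rack.act' x ^ n = 1) : Rack.act' (p x) ^ n = 1 := by
  rw [act'_apply_of_mem_innerGroup hp, conj_pow, hx, mul_one, mul_inv_cancel]

theorem mem_quandleComponent_iff {x y : Q} :
    y ∈ quandleComponent x ↔ ∃ p ∈ innerGroup Q, p x = y :=
  ⟨fun ⟨p, h⟩ => ⟨p, p.2, h⟩, fun ⟨p, hp, h⟩ => ⟨⟨p, hp⟩, h⟩⟩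

theorem quandleComponent_eq_of_mem {x y : Q} (h : y ∈ quandleComponent x) :
    quandleComponent y = quandleComponent x :=
  MulAction.orbit_eq_iff.2 h

theorem quandleComponent_eq_of_mapsTo {S : Set (Equiv.Perm Q)} {K : Set Q} {x : Q}
    (hS : ∀ p ∈ S, IsOfFinOrder p) (hle : innerGroup Q ≤ Subgroup.closure S)
    (hK : ∀ p ∈ S, Set.MapsTo p K K) (hx : x ∈ K) (hsub : K ⊆ quandleComponent x) :
    quandleComponent x = K := by
  refine Set.Subset.antisymm (fun y hy => ?_) hsub
  obtain ⟨p, hp, rfl⟩ := mem_quandleComponent_iff.1 hy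
  exact mapsTo_of_mem_closure hS hK (hle hp) hx

end InnerGroup

section PresentedQuandle

variable {X : Type} {R : QTerm X → QTerm X → Prop} {Q : Type*} [Quandle Q]

/-- The value of a term in a quandle, for given values of the generators. -/
def QTerm.eval (f : X → Q) : QTerm X → Q
  | .of x => f x
  | .rhd s t => t.eval f ◃ s.eval f
  | .rhdInv s t => t.eval f ◃⁻¹ s.eval f

theorem QTerm.eval_iterate_rhd (f : X → Q) (x y : X) (n : ℕ) :
    ((fun s => QTerm.rhd s (.of y))^[n] (.of x)).eval f = (Rack.act' (f y) ^ n) (f x) := by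
  induction n with
  | zero => rfl
  | succ n ih =>
    rw [Function.iterate_succ_apply', eval, ih, pow_succ']
    rfl

theorem QTerm.Rel.eval_eq {f : X → Q} (hf : ∀ s t, R s t → s.eval f = t.eval f) {s t : QTerm X}
    (h : QTerm.Rel R s t) : s.eval f = t.eval f := by
  induction h with
  | of h => exact hf _ _ h
  | refl => rfl
  | symm _ ih => exact ih.symm
  | trans _ _ ih ih' => exact ih.trans ih'
  | rhd_congr _ _ ih ih' => simp only [eval, ih, ih']
  | rhdInv_congr _ _ ih ih' => simp only [eval, ih, ih']
  | idem => exact Quandle.fix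
  | rhd_rhdInv => exact Rack.left_inv _ _
  | rhdInv_rhd => exact Rack.right_inv _ _
  | distrib => exact Shelf.self_distrib

namespace PresentedQuandle

/-- The universal property of `⟨X | R⟩`: values of the generators that satisfy the relations
extend to a quandle homomorphism. -/
def lift (f : X → Q) (hf : ∀ s t, R s t → s.eval f = t.eval f) : PresentedQuandle R →◃ Q where
  toFun := Quotient.lift (QTerm.eval f) fun _ _ h => QTerm.Rel.eval_eq hf h
  map_act' := by
    rintro ⟨_⟩ ⟨_⟩
    rfl

theorem eval_mk_of (s : QTerm X) : s.eval (fun x => mk R (.of x)) = mk R s := by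
  induction s with
  | of x => rfl
  | rhd s t hs ht => exact congrArg₂ (· ◃ ·) ht hs
  | rhdInv s t hs ht => exact congrArg₂ (· ◃⁻¹ ·) ht hs

theorem mk_eq_of_rel {s t : QTerm X} (h : R s t) : mk R s = mk R t :=
  Quotient.sound (QTerm.Rel.of h)

theorem induction_on {p : PresentedQuandle R → Prop} (z : PresentedQuandle R)
    (of : ∀ x, p (mk R (.of x))) (act : ∀ y z, p y → p z → p (Rack.act' y z))
    (invAct : ∀ y z, p y → p z → p ((Rack.act' y)⁻¹ z)) : p z := by
  induction z using Quotient.inductionOn with | _ s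
  induction s with
  | of x => exact of x
  | rhd s t hs ht => exact act _ _ ht hs
  | rhdInv s t hs ht => exact invAct _ _ ht hs

theorem innerGroup_le {H : Subgroup (Equiv.Perm (PresentedQuandle R))}
    (h : ∀ x, Rack.act' (mk R (.of x)) ∈ H) : innerGroup (PresentedQuandle R) ≤ H := by
  refine (Subgroup.closure_le H).2 ?_
  rintro _ ⟨z, rfl⟩
  change Rack.act' z ∈ H
  induction z using induction_on with
  | of x => exact h x
  | act y z hy hz =>
    rw [act'_apply_of_mem_innerGroup (act'_mem_innerGroup y)]
    exact H.mul_mem (H.mul_mem hy hz) (H.inv_mem hy)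
  | invAct y z hy hz =>
    rw [act'_apply_of_mem_innerGroup (inv_mem (act'_mem_innerGroup y)), inv_inv]
    exact H.mul_mem (H.mul_mem (H.inv_mem hy) hz) hy

theorem exists_mem_quandleComponent_of (z : PresentedQuandle R) :
    ∃ x, z ∈ quandleComponent (mk R (.of x)) := by
  simp only [mem_quandleComponent_iff]
  induction z using induction_on with
  | of x => exact ⟨x, 1, one_mem _, rfl⟩
  | act y z _ hz =>
    obtain ⟨x, p, hp, rfl⟩ := hz
    exact ⟨x, _, mul_mem (act'_mem_innerGroup y) hp, rfl⟩
  | invAct y z _ hz =>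
    obtain ⟨x, p, hp, rfl⟩ := hz
    exact ⟨x, _, mul_mem (inv_mem (act'_mem_innerGroup y)) hp, rfl⟩

theorem eq_one_of_forall_of {p : Equiv.Perm (PresentedQuandle R)}
    (hp : p ∈ innerGroup (PresentedQuandle R))
    (h : ∀ x, p (mk R (.of x)) = mk R (.of x)) : p = 1 := by
  have commute : ∀ y, p y = y → p * Rack.act' y = Rack.act' y * p := fun y hy => by
    conv_rhs => rw [← hy, act'_apply_of_mem_innerGroup hp, inv_mul_cancel_right]
  ext z
  rw [Equiv.Perm.one_apply]
  induction z using induction_on with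
  | of x => exact h x
  | act y z hy hz => rw [← Equiv.Perm.mul_apply, commute y hy, Equiv.Perm.mul_apply, hz]
  | invAct y z hy hz =>
    rw [Equiv.Perm.eq_inv_iff_eq, ← Equiv.Perm.mul_apply, ← commute y hy, Equiv.Perm.mul_apply]
    simp [hz]

end PresentedQuandle

end PresentedQuandle

/-! ### Colourings of link diagrams -/

theorem zpow_units_eq_self_of_sq_eq_one {G : Type*} [Group G] {g : G} (hg : g ^ 2 = 1) (s : ℤˣ) :
    g ^ (s : ℤ) = g := by
  obtain rfl | rfl := Int.units_eq_one_or s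
  · rw [Units.val_one, zpow_one]
  · rw [Units.val_neg, Units.val_one, zpow_neg_one, inv_eq_of_mul_eq_one_right (by rwa [← sq])]

namespace LinkDiagram

variable {r : ℕ} {D : LinkDiagram r} {o : D.Orientation} {N : Fin r → ℕ} {Q : Type*} [Quandle Q]

/-- The sign of an end of a crossing: `1` if the edge there is directed away from the crossing,
`-1` if it is directed towards it. -/
def Orientation.sign (o : D.Orientation) (x : D.Crossing × Fin 4) : ℤˣ :=
  if o.out x then 1 else -1

theorem Orientation.sign_add_two (o : D.Orientation) (c : D.Crossing) (i : Fin 4) :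
    o.sign (c, i + 2) = -o.sign (c, i) := by
  rw [sign, sign, o.through]
  cases o.out (c, i) <;> simp

theorem Orientation.sign_eq_neg (o : D.Orientation) {x y : D.Crossing × Fin 4} (hne : x ≠ y)
    (h : D.edge x = D.edge y) : o.sign y = -o.sign x := by
  rw [sign, sign, o.along x y hne h]
  cases o.out x <;> simp

/-- The colours of the edges at the crossing `c` satisfy the Wirtinger relations of this crossing,
if the end `i` belongs to the over-strand. The under-edge at the end `i + 1` is the one on the left
if the over-strand is directed from `i + 2` to `i`. -/
structure ColorsAt (o : D.Orientation) (f : D.Edge → Q) (c : D.Crossing) (i : Fin 4) : Prop where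
  over_eq : f (D.edge (c, i)) = f (D.edge (c, i + 2))
  under_eq : f (D.edge (c, i + 1)) =
    (Rack.act' (f (D.edge (c, i))) ^ (o.sign (c, i) : ℤ)) (f (D.edge (c, i + 3)))

theorem ColorsAt.add_two {f : D.Edge → Q} {c : D.Crossing} {i : Fin 4} (h : ColorsAt o f c i) :
    ColorsAt o f c (i + 2) where
  over_eq := by rw [show i + 2 + 2 = i by lia, h.over_eq]
  under_eq := by
    rw [show i + 2 + 1 = i + 3 by lia, show i + 2 + 3 = i + 1 by lia, ← h.over_eq, o.sign_add_two,
      Units.val_neg, zpow_neg, Equiv.Perm.eq_inv_iff_eq, h.under_eq]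

theorem colorsAt_iff_of_sq_eq_one {f : D.Edge → Q} {c : D.Crossing} {i : Fin 4}
    (h : Rack.act' (f (D.edge (c, i))) ^ 2 = 1) :
    ColorsAt o f c i ↔ f (D.edge (c, i)) = f (D.edge (c, i + 2)) ∧
      f (D.edge (c, i + 1)) = f (D.edge (c, i)) ◃ f (D.edge (c, i + 3)) := by
  refine ⟨fun H => ⟨H.over_eq, ?_⟩, fun H => ⟨H.1, ?_⟩⟩
  · rw [H.under_eq, zpow_units_eq_self_of_sq_eq_one h, Rack.act'_apply]
  · rw [H.2, zpow_units_eq_self_of_sq_eq_one h, Rack.act'_apply]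

/-- A colouring of the edges of an oriented link diagram by a quandle: the values of the generators
of the fundamental `N`-quandle under a homomorphism. -/
structure IsColoring (o : D.Orientation) (N : Fin r → ℕ) (f : D.Edge → Q) : Prop where
  colorsAt (c i) (h : D.IsOver c i) : ColorsAt o f c i
  pow_eq_one (e) : Rack.act' (f e) ^ N (D.comp e) = 1

theorem colorsAt_of_isOver {f : D.Edge → Q} {c : D.Crossing} {i j : Fin 4} (hi : D.IsOver c i)
    (hj : D.IsOver c j) (h : ColorsAt o f c i) : ColorsAt o f c j := by
  have parity : i.val % 2 = 0 ↔ j.val % 2 = 0 := hi.trans hj.symm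
  obtain rfl | rfl : j = i ∨ j = i + 2 := by lia
  · exact h
  · exact h.add_two

namespace IsColoring

variable {f : D.Edge → Q}

theorem eval_eq (h : IsColoring o N f) {s t : QTerm D.Edge} (hst : D.NWirtingerRel o N s t) :
    s.eval f = t.eval f := by
  cases hst with
  | wirtinger hst =>
    obtain ⟨c, i, hi⟩ | ⟨c, i, hi, hout⟩ := hst
    · exact (h.colorsAt c i hi).over_eq
    · refine (h.colorsAt c i hi).under_eq.trans ?_
      rw [Orientation.sign, if_pos hout, Units.val_one, zpow_one]
      rfl
  | power x y =>
    rw [QTerm.eval_iterate_rhd, h.pow_eq_one]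
    rfl

/-- The quandle homomorphism that extends a colouring. -/
def lift (h : IsColoring o N f) : D.NQuandle o N →◃ Q :=
  PresentedQuandle.lift f fun _ _ => h.eval_eq

end IsColoring

theorem isColoring_arc (o : D.Orientation) (N : Fin r → ℕ) : IsColoring o N (D.arc o N) where
  colorsAt c i hi := by
    have colorsAt_of_out : ∀ i, D.IsOver c i → o.out (c, i) = true →
        ColorsAt o (D.arc o N) c i := fun i hi hout =>
      { over_eq := PresentedQuandle.mk_eq_of_rel (.wirtinger (.over c i hi))
        under_eq := by
          rw [Orientation.sign, if_pos hout, Units.val_one, zpow_one]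
          exact PresentedQuandle.mk_eq_of_rel (.wirtinger (.under c i hi hout)) }
    by_cases hout : o.out (c, i) = true
    · exact colorsAt_of_out i hi hout
    · have hi2 : D.IsOver c (i + 2) := by
        have parity : i.val % 2 = 0 ↔ D.overEven c = true := hi
        rw [PDCode.IsOver, ← parity]
        lia
      exact colorsAt_of_isOver hi2 hi (colorsAt_of_out _ hi2 (by rw [o.through]; simpa using hout))
  pow_eq_one y := by
    refine PresentedQuandle.eq_one_of_forall_of (pow_mem (act'_mem_innerGroup _) _) fun x => ?_
    have power := PresentedQuandle.mk_eq_of_rel (NWirtingerRel.power (o := o) (N := N) x y)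
    rwa [← PresentedQuandle.eval_mk_of, QTerm.eval_iterate_rhd] at power

end LinkDiagram

/-! ### Dihedral subquandles -/

section DihedralSeq

variable {Q Q' : Type*} [Quandle Q] [Quandle Q'] {x y : Q}

/-- The product of the symmetries at `x` and `y`: the rotation of the dihedral quandle generated by
two elements with involutive symmetries. -/
def dihedralRotation (x y : Q) : Equiv.Perm Q :=
  Rack.act' y * Rack.act' x

/-- The dihedral subquandle generated by two elements `x`, `y` with involutive symmetries, numbered
so that `x` and `y` have the numbers `0` and `1` and `d i ◃ d j = d (2 * i - j)`. -/
def dihedralSeq (x y : Q) (i : ℤ) : Q :=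
  (dihedralRotation x y ^ (i / 2)) (if Even i then x else y)

theorem dihedralSeq_zero (x y : Q) : dihedralSeq x y 0 = x :=
  rfl

theorem dihedralSeq_one (x y : Q) : dihedralSeq x y 1 = y :=
  rfl

theorem dihedralRotation_zpow_dihedralSeq (x y : Q) (j i : ℤ) :
    (dihedralRotation x y ^ j) (dihedralSeq x y i) = dihedralSeq x y (i + 2 * j) := by
  rw [dihedralSeq, dihedralSeq, ← Equiv.Perm.mul_apply, ← zpow_add,
    show (i + 2 * j) / 2 = j + i / 2 by lia]
  simp only [Int.even_add, even_two_mul, iff_true]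

theorem semiconj_act' (φ : Q →◃ Q') (z : Q) :
    Function.Semiconj φ (Rack.act' z) (Rack.act' (φ z)) := fun _ =>
  ShelfHom.map_act φ

theorem semiconj_dihedralRotation (φ : Q →◃ Q') (x y : Q) :
    Function.Semiconj φ (dihedralRotation x y) (dihedralRotation (φ x) (φ y)) := fun z => by
  simp only [dihedralRotation, Equiv.Perm.mul_apply, Rack.act'_apply, ShelfHom.map_act]

theorem map_dihedralSeq (φ : Q →◃ Q') (x y : Q) (i : ℤ) :
    φ (dihedralSeq x y i) = dihedralSeq (φ x) (φ y) i := by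
  rw [dihedralSeq, dihedralSeq, semiconj_zpow (semiconj_dihedralRotation φ x y), apply_ite φ]

theorem semiconjBy_act'_dihedralRotation (hx : Rack.act' x ^ 2 = 1) (hy : Rack.act' y ^ 2 = 1) :
    SemiconjBy (Rack.act' x) (dihedralRotation x y) (dihedralRotation x y)⁻¹ := by
  rw [SemiconjBy, dihedralRotation, mul_inv_rev, inv_eq_of_mul_eq_one_right (sq (Rack.act' x) ▸ hx),
    inv_eq_of_mul_eq_one_right (sq (Rack.act' y) ▸ hy), mul_assoc]

theorem act'_eq_dihedralRotation_mul (hx : Rack.act' x ^ 2 = 1) :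
    Rack.act' y = dihedralRotation x y * Rack.act' x := by
  rw [dihedralRotation, mul_assoc, ← sq, hx, mul_one]

theorem apply_dihedralSeq_add_two_mul {p : Equiv.Perm Q}
    (hR : SemiconjBy p (dihedralRotation x y) (dihedralRotation x y)⁻¹) {a b : ℤ}
    (h : p (dihedralSeq x y a) = dihedralSeq x y b) (j : ℤ) :
    p (dihedralSeq x y (a + 2 * j)) = dihedralSeq x y (b - 2 * j) := by
  have conj := DFunLike.congr_fun (hR.zpow_right j).eq (dihedralSeq x y a)
  rwa [inv_zpow', Equiv.Perm.mul_apply, Equiv.Perm.mul_apply, h, dihedralRotation_zpow_dihedralSeq,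
    dihedralRotation_zpow_dihedralSeq, mul_neg, ← sub_eq_add_neg] at conj

theorem apply_dihedralSeq_of_odd_sub {p : Equiv.Perm Q} (hp : p ^ 2 = 1)
    (hR : SemiconjBy p (dihedralRotation x y) (dihedralRotation x y)⁻¹) {a b : ℤ}
    (hab : Odd (a - b)) (h : p (dihedralSeq x y a) = dihedralSeq x y b) (s : ℤ) :
    p (dihedralSeq x y s) = dihedralSeq x y (a + b - s) := by
  have swapped : p (dihedralSeq x y b) = dihedralSeq x y a := by
    rw [← h, ← Equiv.Perm.mul_apply, ← sq, hp, Equiv.Perm.one_apply]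
  obtain ⟨i, hi⟩ := hab
  obtain ⟨j, hj⟩ | ⟨j, hj⟩ := Int.even_or_odd (s - a)
  · rw [show s = a + 2 * j by lia, apply_dihedralSeq_add_two_mul hR h]
    congr 1
    lia
  · rw [show s = b + 2 * (j + i + 1) by lia, apply_dihedralSeq_add_two_mul hR swapped]
    congr 1
    lia

theorem act'_apply_dihedralSeq (hx : Rack.act' x ^ 2 = 1) (hy : Rack.act' y ^ 2 = 1) (s : ℤ) :
    Rack.act' x (dihedralSeq x y s) = dihedralSeq x y (-s) := by
  have hR := semiconjBy_act'_dihedralRotation hx hy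
  have apply_zero : Rack.act' x (dihedralSeq x y 0) = dihedralSeq x y 0 := Quandle.fix
  have apply_one : Rack.act' x (dihedralSeq x y 1) = dihedralSeq x y (-1) := by
    have rot : (dihedralRotation x y ^ (-1 : ℤ)) (dihedralSeq x y 1) = dihedralSeq x y (-1) :=
      dihedralRotation_zpow_dihedralSeq x y (-1) 1
    rw [← rot, zpow_neg_one, eq_inv_mul_of_mul_eq (act'_eq_dihedralRotation_mul (y := y) hx).symm]
    exact congrArg ⇑(dihedralRotation x y)⁻¹ (Quandle.fix (x := y))
  obtain ⟨j, rfl | rfl⟩ := Int.even_or_odd' s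
  · simpa only [zero_add, zero_sub] using apply_dihedralSeq_add_two_mul hR apply_zero j
  · simpa only [neg_add_rev, add_comm, sub_eq_add_neg] using
      apply_dihedralSeq_add_two_mul hR apply_one j

theorem dihedralSeq_eq_of_act_eq {u : ℤ → Q}
    (hu : ∀ i j, u i ◃ u j = u (2 * i - j)) (i : ℤ) : dihedralSeq (u 0) (u 1) i = u i := by
  have semiconj : Function.Semiconj u (Equiv.addRight 2) (dihedralRotation (u 0) (u 1)) := by
    intro j
    rw [dihedralRotation, Equiv.Perm.mul_apply, Rack.act'_apply, Rack.act'_apply, hu, hu]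
    congr 1
    simp only [Equiv.coe_addRight]
    lia
  rw [dihedralSeq, ← apply_ite u, ← semiconj_zpow semiconj, Equiv.zsmul_addRight]
  congr 1
  simp only [Equiv.coe_addRight, smul_eq_mul]
  split_ifs <;> grind

end DihedralSeq

section DihedralSeqInnerGroup

variable {Q : Type} [Quandle Q] {x y : Q}

theorem dihedralRotation_mem_innerGroup (x y : Q) : dihedralRotation x y ∈ innerGroup Q :=
  mul_mem (act'_mem_innerGroup y) (act'_mem_innerGroup x)

theorem act'_dihedralSeq (hx : Rack.act' x ^ 2 = 1) (hy : Rack.act' y ^ 2 = 1) (i : ℤ) :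
    Rack.act' (dihedralSeq x y i) = dihedralRotation x y ^ i * Rack.act' x := by
  have conj := ((semiconjBy_act'_dihedralRotation hx hy).zpow_right (-(i / 2))).eq
  rw [inv_zpow', neg_neg] at conj
  rw [dihedralSeq, act'_apply_of_mem_innerGroup (zpow_mem (dihedralRotation_mem_innerGroup x y) _),
    ← zpow_neg]
  split_ifs with hi
  · rw [mul_assoc, conj, ← mul_assoc, ← zpow_add, ← two_mul, Int.two_mul_ediv_two_of_even hi]
  · rw [act'_eq_dihedralRotation_mul hx, mul_assoc, mul_assoc, conj, ← mul_assoc, ← mul_assoc,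
      ← zpow_add_one, ← zpow_add, add_right_comm, ← two_mul,
      Int.two_mul_ediv_two_add_one_of_odd (Int.not_even_iff_odd.1 hi)]

theorem sq_act'_dihedralSeq (hx : Rack.act' x ^ 2 = 1) (hy : Rack.act' y ^ 2 = 1) (i : ℤ) :
    Rack.act' (dihedralSeq x y i) ^ 2 = 1 := by
  refine act'_apply_pow_eq_one (zpow_mem (dihedralRotation_mem_innerGroup x y) _) ?_
  split_ifs
  exacts [hx, hy]

theorem dihedralSeq_act_dihedralSeq (hx : Rack.act' x ^ 2 = 1) (hy : Rack.act' y ^ 2 = 1)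
    (i j : ℤ) : dihedralSeq x y i ◃ dihedralSeq x y j = dihedralSeq x y (2 * i - j) := by
  rw [← Rack.act'_apply, act'_dihedralSeq hx hy, Equiv.Perm.mul_apply,
    act'_apply_dihedralSeq hx hy, dihedralRotation_zpow_dihedralSeq]
  congr 1
  lia

end DihedralSeqInnerGroup

/-! ### The relations of the twist links -/

section TwistRelations

variable {Q : Type*} [Quandle Q] {k : ℤ} {x y c : Q} {Z : Equiv.Perm Q}

/-- The relations of a presentation of the fundamental `(2,3)`-quandle of `M_k`: the generators
`x`, `y` are the two strands inside the circle and `c` is the left half of the circle. The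
permutation `Z` is the symmetry at `c` or its inverse, depending on the orientation of the
circle; `dihedralSeq x y` runs through the arcs of the block of half-twists. -/
structure TwistRelations (k : ℤ) (x y c : Q) (Z : Equiv.Perm Q) : Prop where
  sq_top : Rack.act' x ^ 2 = 1
  sq_bot : Rack.act' y ^ 2 = 1
  cube_circle : Rack.act' c ^ 3 = 1
  exists_sign : ∃ ε : ℤˣ, Z = Rack.act' c ^ (ε : ℤ)
  circle : y ◃ x ◃ c = c
  clasp_top : Z x = dihedralSeq x y (1 - k) ◃ Z y
  clasp_bot : dihedralSeq x y (-k) = Z x ◃ dihedralSeq x y (1 - k)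

namespace TwistRelations

theorem cube (h : TwistRelations k x y c Z) : Z ^ 3 = 1 := by
  obtain ⟨ε, rfl⟩ := h.exists_sign
  rw [← zpow_natCast, ← zpow_mul', zpow_mul, zpow_natCast, h.cube_circle, one_zpow]

theorem mul_self (h : TwistRelations k x y c Z) : Z * Z = Z⁻¹ :=
  eq_inv_of_mul_eq_one_left (by rw [← pow_three', h.cube])

theorem apply_circle (h : TwistRelations k x y c Z) : Z c = c := by
  obtain ⟨ε, rfl⟩ := h.exists_sign
  have fix : Function.IsFixedPt (Rack.act' c) c := Quandle.fix
  exact fix.perm_zpow ε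

theorem act'_circle (h : TwistRelations k x y c Z) : ∃ ε : ℤˣ, Rack.act' c = Z ^ (ε : ℤ) := by
  obtain ⟨ε, rfl⟩ := h.exists_sign
  exact ⟨ε, by rw [← zpow_mul, Int.units_coe_mul_self, zpow_one]⟩

end TwistRelations

end TwistRelations

section Periodicity

variable {Q : Type} [Quandle Q] {k : ℤ} {x y c : Q} {Z : Equiv.Perm Q}

namespace TwistRelations

theorem mem_innerGroup (h : TwistRelations k x y c Z) : Z ∈ innerGroup Q := by
  obtain ⟨ε, rfl⟩ := h.exists_sign
  exact zpow_mem (act'_mem_innerGroup c) _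

theorem commute_dihedralRotation (h : TwistRelations k x y c Z) :
    Commute Z (dihedralRotation x y) := by
  obtain ⟨ε, rfl⟩ := h.exists_sign
  refine Commute.zpow_left ?_ _
  have conj := act'_apply_of_mem_innerGroup (dihedralRotation_mem_innerGroup x y) c
  rw [show dihedralRotation x y c = c from h.circle, eq_mul_inv_iff_mul_eq] at conj
  exact conj

variable {p : Equiv.Perm Q}

theorem semiconjBy_act'_apply (h : TwistRelations k x y c Z) (hp : p ∈ innerGroup Q)
    (hR : Commute p (dihedralRotation x y)) :
    SemiconjBy (Rack.act' (p x)) (dihedralRotation x y) (dihedralRotation x y)⁻¹ := by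
  rw [act'_apply_of_mem_innerGroup hp]
  have hX := semiconjBy_act'_dihedralRotation h.sq_top h.sq_bot
  exact (hR.inv_right.semiconjBy.mul_left hX).mul_left hR.inv_left

theorem act'_apply_dihedralSeq (h : TwistRelations k x y c Z) (s : ℤ) :
    Rack.act' (Z x) (dihedralSeq x y s) = dihedralSeq x y (-(2 * k - 1) - s) := by
  rw [apply_dihedralSeq_of_odd_sub (act'_apply_pow_eq_one h.mem_innerGroup h.sq_top)
    (h.semiconjBy_act'_apply h.mem_innerGroup h.commute_dihedralRotation) ⟨0, by lia⟩
    h.clasp_bot.symm]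
  congr 1
  lia

theorem act'_inv_apply_dihedralSeq (h : TwistRelations k x y c Z) (s : ℤ) :
    Rack.act' (Z⁻¹ x) (dihedralSeq x y s) = dihedralSeq x y (2 * k - 1 - s) := by
  have apply_one : Rack.act' (Z⁻¹ x) (dihedralSeq x y 1) = dihedralSeq x y (2 * (k - 1)) := by
    have clasp := h.clasp_top
    rw [← Rack.act'_apply, act'_dihedralSeq h.sq_top h.sq_bot, ← neg_sub, zpow_neg,
      Equiv.Perm.mul_apply, Equiv.Perm.eq_inv_iff_eq] at clasp
    rw [act'_apply_of_mem_innerGroup (inv_mem h.mem_innerGroup), inv_inv, mul_assoc,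
      Equiv.Perm.mul_apply, Equiv.Perm.mul_apply, dihedralSeq_one, ← clasp,
      ← Equiv.Perm.mul_apply, ← Equiv.Perm.mul_apply, mul_assoc,
      ← (h.commute_dihedralRotation.zpow_right (k - 1)).eq, inv_mul_cancel_left, ← zero_add (2 * _)]
    exact dihedralRotation_zpow_dihedralSeq x y (k - 1) 0
  rw [apply_dihedralSeq_of_odd_sub (act'_apply_pow_eq_one (inv_mem h.mem_innerGroup) h.sq_top)
    (h.semiconjBy_act'_apply (inv_mem h.mem_innerGroup) h.commute_dihedralRotation.inv_left)
    ⟨1 - k, by lia⟩ apply_one]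
  congr 1
  lia

theorem act'_apply_mul_act'_apply (h : TwistRelations k x y c Z) (hp : p ∈ innerGroup Q)
    (hR : Commute p (dihedralRotation x y)) :
    Rack.act' (p (Z x)) * Rack.act' (p x) =
      dihedralRotation x y ^ (-(2 * k - 1)) * (Rack.act' (p x) * Rack.act' (p (Z x))) := by
  have base : Rack.act' (Z x) * Rack.act' x =
      dihedralRotation x y ^ (-(2 * k - 1)) * (Rack.act' x * Rack.act' (Z x)) := by
    have conj := act'_apply_of_mem_innerGroup (act'_mem_innerGroup (Z x)) (dihedralSeq x y 0)
    rw [h.act'_apply_dihedralSeq, sub_zero, act'_dihedralSeq h.sq_top h.sq_bot,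
      eq_mul_inv_iff_mul_eq] at conj
    exact conj.symm.trans (mul_assoc _ _ _)
  have conj : ∀ z, Rack.act' (p z) = MulAut.conj p (Rack.act' z) := fun z =>
    act'_apply_of_mem_innerGroup hp z
  rw [conj, conj, ← map_mul, base, map_mul, map_mul, MulAut.conj_apply p (_ ^ _),
    (hR.zpow_right _).eq, mul_inv_cancel_right]

theorem dihedralSeq_add (h : TwistRelations k x y c Z) (s : ℤ) :
    dihedralSeq x y (s + 6 * (2 * k - 1)) = dihedralSeq x y s := by
  have key := DFunLike.congr_fun (h.act'_apply_mul_act'_apply h.mem_innerGroup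
    h.commute_dihedralRotation) (dihedralSeq x y (s + 4 * (2 * k - 1)))
  rw [← Equiv.Perm.mul_apply Z, h.mul_self] at key
  simp only [Equiv.Perm.mul_apply, h.act'_apply_dihedralSeq, h.act'_inv_apply_dihedralSeq,
    dihedralRotation_zpow_dihedralSeq] at key
  convert key using 2 <;> lia

end TwistRelations

end Periodicity

section TwistElements

variable {Q Q' : Type*} [Quandle Q] [Quandle Q'] {x y c : Q} {Z : Equiv.Perm Q}

/-- The elements of the component of the twist knot: the images of the arcs of the half-twists under
the powers of the symmetry at the circle. -/
def knotElement (x y : Q) (Z : Equiv.Perm Q) (v : ℤ × ℤ) : Q :=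
  (Z ^ v.1) (dihedralSeq x y v.2)

/-- The elements of the component of the circle: the images of `c` under products of the symmetries
at `x`, `Z x` and `Z⁻¹ x`. -/
def circleElement (x c : Q) (Z : Equiv.Perm Q) (v : Fin 2 × Fin 2 × Fin 2) : Q :=
  (Rack.act' x ^ v.1.val * Rack.act' (Z x) ^ v.2.1.val * Rack.act' (Z⁻¹ x) ^ v.2.2.val) c

theorem map_knotElement (φ : Q →◃ Q') {Z' : Equiv.Perm Q'}
    (hZ : Function.Semiconj φ Z Z') (v : ℤ × ℤ) :
    φ (knotElement x y Z v) = knotElement (φ x) (φ y) Z' v := by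
  rw [knotElement, knotElement, semiconj_zpow hZ, map_dihedralSeq]

theorem map_circleElement (φ : Q →◃ Q') {Z' : Equiv.Perm Q'}
    (hZ : Function.Semiconj φ Z Z') (v : Fin 2 × Fin 2 × Fin 2) :
    φ (circleElement x c Z v) = circleElement (φ x) (φ c) Z' v := by
  have act'_pow : ∀ (z w : Q) (n : ℕ),
      φ ((Rack.act' z ^ n) w) = (Rack.act' (φ z) ^ n) (φ w) := fun z w n => by
    simpa only [zpow_natCast] using semiconj_zpow (semiconj_act' φ z) n w
  have hZinv : φ (Z⁻¹ x) = Z'⁻¹ (φ x) := by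
    simpa only [zpow_neg_one] using semiconj_zpow hZ (-1) x
  simp only [circleElement, Equiv.Perm.mul_apply, act'_pow, hZ x, hZinv]

end TwistElements

section Components

variable {Q : Type} [Quandle Q] {k : ℤ} {x y c : Q} {Z : Equiv.Perm Q}

theorem range_circleElement_subset (x c : Q) (Z : Equiv.Perm Q) :
    Set.range (circleElement x c Z) ⊆ quandleComponent c := by
  rintro _ ⟨v, rfl⟩
  exact mem_quandleComponent_iff.2 ⟨_, mul_mem (mul_mem (pow_mem (act'_mem_innerGroup x) _)
    (pow_mem (act'_mem_innerGroup _) _)) (pow_mem (act'_mem_innerGroup _) _), rfl⟩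

namespace TwistRelations

theorem knotElement_eq_of_modEq (h : TwistRelations k x y c Z) {v w : ℤ × ℤ}
    (h₁ : v.1 ≡ w.1 [ZMOD 3]) (h₂ : v.2 ≡ w.2 [ZMOD 6 * (2 * k - 1)]) :
    knotElement x y Z v = knotElement x y Z w := by
  have periodic : Function.Periodic (dihedralSeq x y) (6 * (2 * k - 1)) := h.dihedralSeq_add
  have seq_eq : dihedralSeq x y v.2 = dihedralSeq x y w.2 := by
    obtain ⟨n, hn⟩ := h₂.dvd
    rw [show w.2 = v.2 + n * (6 * (2 * k - 1)) by lia]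
    exact (periodic.int_mul n v.2).symm
  rw [knotElement, knotElement, seq_eq, zpow_eq_zpow_emod' v.1 h.cube,
    zpow_eq_zpow_emod' w.1 h.cube]
  congr 2

theorem mapsTo_dihedralRotation_zpow (h : TwistRelations k x y c Z) (i : ℤ) :
    Set.MapsTo ⇑(dihedralRotation x y ^ i) (Set.range (knotElement x y Z))
      (Set.range (knotElement x y Z)) := by
  rintro _ ⟨⟨j, s⟩, rfl⟩
  refine ⟨(j, s + 2 * i), ?_⟩
  rw [knotElement, knotElement, ← dihedralRotation_zpow_dihedralSeq, ← Equiv.Perm.mul_apply,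
    ← Equiv.Perm.mul_apply, (h.commute_dihedralRotation.zpow_zpow j i).eq]

theorem mapsTo_act'_knotElement (h : TwistRelations k x y c Z) :
    Set.MapsTo (Rack.act' x) (Set.range (knotElement x y Z)) (Set.range (knotElement x y Z)) := by
  have conj : ∀ p ∈ innerGroup Q, ∀ s, Rack.act' x (p (dihedralSeq x y s)) =
      p (Rack.act' (p⁻¹ x) (dihedralSeq x y s)) := fun p hp s => by
    rw [act'_apply_of_mem_innerGroup (inv_mem hp), inv_inv, ← Equiv.Perm.mul_apply,
      ← Equiv.Perm.mul_apply, mul_assoc, mul_inv_cancel_left]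
  rintro _ ⟨⟨j, s⟩, rfl⟩
  obtain hj | hj | hj : j ≡ 0 [ZMOD 3] ∨ j ≡ 1 [ZMOD 3] ∨ j ≡ -1 [ZMOD 3] := by
    simp only [Int.ModEq]
    lia
  · rw [h.knotElement_eq_of_modEq (v := (j, s)) (w := (0, s)) hj rfl]
    exact ⟨(0, -s), (_root_.act'_apply_dihedralSeq h.sq_top h.sq_bot s).symm⟩
  · rw [h.knotElement_eq_of_modEq (v := (j, s)) (w := (1, s)) hj rfl]
    refine ⟨(1, 2 * k - 1 - s), ?_⟩
    rw [knotElement, knotElement, zpow_one, conj Z h.mem_innerGroup, h.act'_inv_apply_dihedralSeq]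
  · rw [h.knotElement_eq_of_modEq (v := (j, s)) (w := (-1, s)) hj rfl]
    refine ⟨(-1, -(2 * k - 1) - s), ?_⟩
    rw [knotElement, knotElement, zpow_neg_one, conj Z⁻¹ (inv_mem h.mem_innerGroup), inv_inv,
      h.act'_apply_dihedralSeq]

theorem range_knotElement_subset (h : TwistRelations k x y c Z) :
    Set.range (knotElement x y Z) ⊆ quandleComponent x := by
  have even_mem : ∀ i, dihedralSeq x y (2 * i) ∈ quandleComponent x := fun i =>
    mem_quandleComponent_iff.2 ⟨dihedralRotation x y ^ i,
      zpow_mem (dihedralRotation_mem_innerGroup x y) i, by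
        rw [← zero_add (2 * i), ← dihedralRotation_zpow_dihedralSeq, dihedralSeq_zero]⟩
  have apply_mem : ∀ p ∈ innerGroup Q, ∀ z ∈ quandleComponent x, p z ∈ quandleComponent x :=
    fun p hp z hz => by
      obtain ⟨q, hq, rfl⟩ := mem_quandleComponent_iff.1 hz
      exact mem_quandleComponent_iff.2 ⟨p * q, mul_mem hp hq, rfl⟩
  rintro _ ⟨⟨j, s⟩, rfl⟩
  refine apply_mem _ (zpow_mem h.mem_innerGroup j) _ ?_
  obtain ⟨i, rfl | rfl⟩ := Int.even_or_odd' s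
  · exact even_mem i
  · have odd_eq := h.act'_apply_dihedralSeq (2 * (-i - k))
    rw [show -(2 * k - 1) - 2 * (-i - k) = 2 * i + 1 by lia] at odd_eq
    rw [← odd_eq]
    exact apply_mem _ (act'_mem_innerGroup _) _ (even_mem _)

theorem dihedralRotation_apply_act'_apply (h : TwistRelations k x y c Z) {p : Equiv.Perm Q}
    (hp : p ∈ innerGroup Q) (hR : Commute p (dihedralRotation x y)) {z : Q}
    (hz : dihedralRotation x y z = z) :
    dihedralRotation x y (Rack.act' (p x) z) = Rack.act' (p x) z := by
  have conj := DFunLike.congr_fun (h.semiconjBy_act'_apply hp hR).eq z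
  rw [Equiv.Perm.mul_apply, hz, Equiv.Perm.mul_apply, Equiv.Perm.eq_inv_iff_eq] at conj
  exact conj

theorem act'_apply_act'_apply_comm (h : TwistRelations k x y c Z) {p : Equiv.Perm Q}
    (hp : p ∈ innerGroup Q) (hR : Commute p (dihedralRotation x y)) {z : Q}
    (hz : dihedralRotation x y z = z) :
    Rack.act' (p (Z x)) (Rack.act' (p x) z) = Rack.act' (p x) (Rack.act' (p (Z x)) z) := by
  have fix := h.dihedralRotation_apply_act'_apply hp hR <|
    h.dihedralRotation_apply_act'_apply (mul_mem hp h.mem_innerGroup)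
      (hR.mul_left h.commute_dihedralRotation) hz
  have key := DFunLike.congr_fun (h.act'_apply_mul_act'_apply hp hR) z
  simp only [Equiv.Perm.mul_apply] at key fix
  rw [key]
  exact Function.IsFixedPt.perm_zpow fix _

theorem act'_comm_of_fixed (h : TwistRelations k x y c Z) {z : Q}
    (hz : dihedralRotation x y z = z) :
    Rack.act' (Z x) (Rack.act' x z) = Rack.act' x (Rack.act' (Z x) z) ∧
      Rack.act' (Z⁻¹ x) (Rack.act' (Z x) z) = Rack.act' (Z x) (Rack.act' (Z⁻¹ x) z) ∧
      Rack.act' x (Rack.act' (Z⁻¹ x) z) = Rack.act' (Z⁻¹ x) (Rack.act' x z) := by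
  have comm := fun p hp hR => h.act'_apply_act'_apply_comm (p := p) hp hR hz
  have hZ := h.mem_innerGroup
  have hR := h.commute_dihedralRotation
  refine ⟨comm 1 (one_mem _) (.one_left _), ?_, ?_⟩
  · simpa only [← Equiv.Perm.mul_apply Z Z, h.mul_self] using comm Z hZ hR
  · simpa only [← Equiv.Perm.mul_apply Z⁻¹ Z, inv_mul_cancel, Equiv.Perm.one_apply] using
      comm Z⁻¹ (inv_mem hZ) hR.inv_left

theorem semiconjBy_act' (h : TwistRelations k x y c Z) (z : Q) :
    SemiconjBy Z (Rack.act' z) (Rack.act' (Z z)) := by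
  rw [SemiconjBy, act'_apply_of_mem_innerGroup h.mem_innerGroup, inv_mul_cancel_right]

theorem apply_circleElement (h : TwistRelations k x y c Z) (a b e : Fin 2) :
    Z (circleElement x c Z (a, b, e)) = circleElement x c Z (e, a, b) := by
  have fin_two : ∀ i : Fin 2, i = 0 ∨ i = 1 := by decide
  have semiconj := (((h.semiconjBy_act' x).pow_right a.val).mul_right
    ((h.semiconjBy_act' (Z x)).pow_right b.val)).mul_right
    ((h.semiconjBy_act' (Z⁻¹ x)).pow_right e.val)
  rw [circleElement, circleElement, ← Equiv.Perm.mul_apply, semiconj.eq, Equiv.Perm.mul_apply,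
    h.apply_circle, ← Equiv.Perm.mul_apply Z Z, h.mul_self, ← Equiv.Perm.mul_apply Z Z⁻¹,
    mul_inv_cancel, Equiv.Perm.one_apply]
  obtain rfl | rfl := fin_two e
  · rw [Fin.val_zero, pow_zero, mul_one, one_mul]
  · rw [Fin.val_one, pow_one]
    simp only [Equiv.Perm.mul_apply]
    have comm_inv : (Rack.act' (Z⁻¹ x) ^ b.val) (Rack.act' x c) =
        Rack.act' x ((Rack.act' (Z⁻¹ x) ^ b.val) c) := by
      obtain rfl | rfl := fin_two b
      · rfl
      · exact (h.act'_comm_of_fixed h.circle).2.2.symm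
    have fixed : dihedralRotation x y ((Rack.act' (Z⁻¹ x) ^ b.val) c) =
        (Rack.act' (Z⁻¹ x) ^ b.val) c := by
      obtain rfl | rfl := fin_two b
      · exact h.circle
      · exact h.dihedralRotation_apply_act'_apply (inv_mem h.mem_innerGroup)
          h.commute_dihedralRotation.inv_left h.circle
    rw [comm_inv]
    obtain rfl | rfl := fin_two a
    · rfl
    · exact (h.act'_comm_of_fixed fixed).1

theorem mapsTo_act'_circleElement (h : TwistRelations k x y c Z) :
    Set.MapsTo (Rack.act' x) (Set.range (circleElement x c Z))
      (Set.range (circleElement x c Z)) := by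
  rintro _ ⟨⟨a, b, e⟩, rfl⟩
  refine ⟨(a + 1, b, e), ?_⟩
  rw [circleElement, circleElement, ← Equiv.Perm.mul_apply, ← mul_assoc, ← mul_assoc]
  obtain rfl | rfl : a = 0 ∨ a = 1 := by lia
  · simp
  · simp [← sq, h.sq_top]

theorem dihedralRotation_apply_circleElement (h : TwistRelations k x y c Z)
    (v : Fin 2 × Fin 2 × Fin 2) :
    dihedralRotation x y (circleElement x c Z v) = circleElement x c Z v := by
  have fix_pow : ∀ {p : Equiv.Perm Q}, p ∈ innerGroup Q → Commute p (dihedralRotation x y) →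
      ∀ (n : ℕ) {z : Q}, dihedralRotation x y z = z →
        dihedralRotation x y ((Rack.act' (p x) ^ n) z) = (Rack.act' (p x) ^ n) z := by
    intro p hp hR n z hz
    induction n with
    | zero => exact hz
    | succ n ih =>
      rw [pow_succ', Equiv.Perm.mul_apply]
      exact h.dihedralRotation_apply_act'_apply hp hR ih
  have hZ := h.mem_innerGroup
  have hR := h.commute_dihedralRotation
  exact fix_pow (one_mem _) (.one_left _) _ <| fix_pow hZ hR _ <|
    fix_pow (inv_mem hZ) hR.inv_left _ h.circle

theorem quandleComponent_eq (h : TwistRelations k x y c Z)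
    (hle : innerGroup Q ≤ Subgroup.closure {Rack.act' x, Rack.act' y, Z}) :
    quandleComponent x = Set.range (knotElement x y Z) ∧
      quandleComponent c = Set.range (circleElement x c Z) := by
  have fin : ∀ p ∈ ({Rack.act' x, Rack.act' y, Z} : Set (Equiv.Perm Q)), IsOfFinOrder p := by
    rintro _ (rfl | rfl | rfl)
    · exact isOfFinOrder_iff_pow_eq_one.2 ⟨2, two_pos, h.sq_top⟩
    · exact isOfFinOrder_iff_pow_eq_one.2 ⟨2, two_pos, h.sq_bot⟩
    · exact isOfFinOrder_iff_pow_eq_one.2 ⟨3, three_pos, h.cube⟩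
  have act'_bot := act'_eq_dihedralRotation_mul (y := y) h.sq_top
  constructor
  · refine quandleComponent_eq_of_mapsTo fin hle ?_ ⟨(0, 0), rfl⟩ h.range_knotElement_subset
    rintro _ (rfl | rfl | rfl)
    · exact h.mapsTo_act'_knotElement
    · rw [act'_bot]
      have mapsTo := h.mapsTo_dihedralRotation_zpow 1
      rw [zpow_one] at mapsTo
      exact mapsTo.comp h.mapsTo_act'_knotElement
    · rintro _ ⟨⟨j, s⟩, rfl⟩
      exact ⟨(1 + j, s), by rw [knotElement, zpow_one_add]; rfl⟩
  · refine quandleComponent_eq_of_mapsTo fin hle ?_ ⟨(0, 0, 0), rfl⟩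
      (range_circleElement_subset x c Z)
    rintro _ (rfl | rfl | rfl)
    · exact h.mapsTo_act'_circleElement
    · rw [act'_bot]
      rintro z hz
      obtain ⟨v, hv⟩ := h.mapsTo_act'_circleElement hz
      exact ⟨v, by rw [Equiv.Perm.mul_apply, ← hv, h.dihedralRotation_apply_circleElement]⟩
    · rintro _ ⟨⟨a, b, e⟩, rfl⟩
      exact ⟨(e, a, b), (h.apply_circleElement a b e).symm⟩

end TwistRelations

end Components

/-! ### Colourings of the twist links -/

namespace TwistLink

variable {Q : Type} [Quandle Q] {k : ℤ} {x y c : Q} {Z : Equiv.Perm Q}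
  {o : (twistLink k).Orientation} {f : Edge k.natAbs → Q}

/-- The colouring of the diagram of `M_k` that is determined by the colours `x`, `y` of the strands
inside the circle and `c` of the left half of the circle; `Z` is the effect on a strand of passing
under the circle. -/
def coloring (k : ℤ) (x y c : Q) (Z : Equiv.Perm Q) : Edge k.natAbs → Q
  | .topIn => x
  | .botIn => y
  | .a | .claspR => Z x
  | .b => Z y
  | .cN | .cW | .cS => c
  | .cE => x ◃ c
  | .claspL => dihedralSeq x y (1 - k)
  | .top j => dihedralSeq x y (-(k.sign * j))
  | .bot j => dihedralSeq x y (1 - k.sign * j)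

/-- An end of the over-strand of a crossing. -/
def overEnd (k : ℤ) : Crossing k.natAbs → Fin 4
  | .topL | .botL => 3
  | .topR | .botR => 0
  | .claspTop | .claspBot => 1
  | .twist _ => if 0 < k then 2 else 1

theorem isOver_overEnd (k : ℤ) (z : Crossing k.natAbs) :
    (twistLink k).IsOver z (overEnd k z) := by
  change (overEnd k z).val % 2 = 0 ↔ overEven (decide (0 < k)) z = true
  cases z with
  | twist i => by_cases hk : 0 < k <;> simp [overEnd, overEven, hk]
  | _ => simp [overEnd, overEven]

theorem sign_botL (o : (twistLink k).Orientation) :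
    o.sign (.botL, 3) = o.sign (.topL, 3) := by
  have along : o.sign (.botL, 3) = -o.sign (.topL, 1) := o.sign_eq_neg (fun h => by cases h) rfl
  rw [along]
  exact (o.sign_add_two .topL 1).symm

theorem coloring_top_last (k : ℤ) (x y c : Q) (Z : Equiv.Perm Q) :
    coloring k x y c Z (.top (Fin.last _)) = dihedralSeq x y (-k) := by
  rw [coloring, Fin.val_last, Int.sign_mul_natAbs]

theorem coloring_bot_last (k : ℤ) (x y c : Q) (Z : Equiv.Perm Q) :
    coloring k x y c Z (.bot (Fin.last _)) = dihedralSeq x y (1 - k) := by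
  rw [coloring, Fin.val_last, Int.sign_mul_natAbs]

theorem sq_act'_coloring (h : TwistRelations k x y c Z) {e : Edge k.natAbs} (he : comp e = 0) :
    Rack.act' (coloring k x y c Z e) ^ 2 = 1 := by
  cases e with
  | topIn => exact h.sq_top
  | botIn => exact h.sq_bot
  | a | claspR => exact act'_apply_pow_eq_one h.mem_innerGroup h.sq_top
  | b => exact act'_apply_pow_eq_one h.mem_innerGroup h.sq_bot
  | claspL | top j | bot j => exact sq_act'_dihedralSeq h.sq_top h.sq_bot _
  | _ => simp [comp] at he

theorem cube_act'_coloring (h : TwistRelations k x y c Z) {e : Edge k.natAbs} (he : comp e = 1) :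
    Rack.act' (coloring k x y c Z e) ^ 3 = 1 := by
  cases e with
  | cN | cW | cS => exact h.cube_circle
  | cE => exact act'_apply_pow_eq_one (act'_mem_innerGroup x) h.cube_circle
  | _ => simp [comp] at he

theorem colorsAt_coloring_twist (h : TwistRelations k x y c Z) (i : Fin k.natAbs) :
    LinkDiagram.ColorsAt o (coloring k x y c Z) (.twist i) (overEnd k (.twist i)) := by
  have act_eq := dihedralSeq_act_dihedralSeq h.sq_top h.sq_bot
  obtain hk | hk : 0 < k ∨ k < 0 := by have := i.pos; lia
  · rw [overEnd, if_pos hk]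
    refine (LinkDiagram.colorsAt_iff_of_sq_eq_one (sq_act'_coloring h rfl)).2 ⟨?_, ?_⟩
    · change dihedralSeq x y (1 - k.sign * (i.val + 1 : ℕ)) = dihedralSeq x y (-(k.sign * i))
      rw [Int.sign_eq_one_of_pos hk]
      congr 1
      lia
    · change dihedralSeq x y (-(k.sign * (i.val + 1 : ℕ))) =
        dihedralSeq x y (1 - k.sign * (i.val + 1 : ℕ)) ◃ dihedralSeq x y (1 - k.sign * i)
      rw [act_eq, Int.sign_eq_one_of_pos hk]
      congr 1
      lia
  · rw [overEnd, if_neg hk.not_gt]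
    refine (LinkDiagram.colorsAt_iff_of_sq_eq_one (sq_act'_coloring h rfl)).2 ⟨?_, ?_⟩
    · change dihedralSeq x y (1 - k.sign * i) = dihedralSeq x y (-(k.sign * (i.val + 1 : ℕ)))
      rw [Int.sign_eq_neg_one_of_neg hk]
      congr 1
      lia
    · change dihedralSeq x y (1 - k.sign * (i.val + 1 : ℕ)) =
        dihedralSeq x y (1 - k.sign * i) ◃ dihedralSeq x y (-(k.sign * i))
      rw [act_eq, Int.sign_eq_neg_one_of_neg hk]
      congr 1
      lia

theorem colorsAt_coloring (hZ : Z = Rack.act' c ^ (o.sign (.topL, 3) : ℤ))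
    (h : TwistRelations k x y c Z) (z : Crossing k.natAbs) :
    LinkDiagram.ColorsAt o (coloring k x y c Z) z (overEnd k z) := by
  have iff_knot {z : Crossing k.natAbs} {i} (hz : comp (ends z i) = 0) :=
    LinkDiagram.colorsAt_iff_of_sq_eq_one (o := o) (c := z) (sq_act'_coloring h hz)
  cases z with
  | topL => exact ⟨rfl, DFunLike.congr_fun hZ x⟩
  | botL => exact ⟨rfl, (DFunLike.congr_fun hZ y).trans (by rw [← sign_botL]; rfl)⟩
  | topR =>
    refine (iff_knot rfl).2 ⟨?_, rfl⟩
    change x = dihedralSeq x y (-(k.sign * 0))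
    rw [mul_zero, neg_zero, dihedralSeq_zero]
  | botR =>
    refine (iff_knot rfl).2 ⟨?_, h.circle.symm⟩
    change y = dihedralSeq x y (1 - k.sign * 0)
    rw [mul_zero, sub_zero, dihedralSeq_one]
  | claspTop =>
    refine (iff_knot rfl).2 ⟨(coloring_bot_last k x y c Z).symm, h.clasp_top⟩
  | claspBot =>
    refine (iff_knot rfl).2 ⟨rfl, (coloring_top_last k x y c Z).trans h.clasp_bot⟩
  | twist i => exact colorsAt_coloring_twist h i

theorem isColoring_coloring (hZ : Z = Rack.act' c ^ (o.sign (.topL, 3) : ℤ))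
    (h : TwistRelations k x y c Z) :
    LinkDiagram.IsColoring o ![2, 3] (coloring k x y c Z) where
  colorsAt z i hi :=
    LinkDiagram.colorsAt_of_isOver (isOver_overEnd k z) hi (colorsAt_coloring hZ h z)
  pow_eq_one e := by
    obtain he | he : comp e = 0 ∨ comp e = 1 := by lia
    · rw [show (twistLink k).comp e = 0 from he]
      exact sq_act'_coloring h he
    · rw [show (twistLink k).comp e = 1 from he]
      exact cube_act'_coloring h he

theorem sq_act'_eq_one (h : LinkDiagram.IsColoring o ![2, 3] f) {e : Edge k.natAbs}
    (he : comp e = 0) : Rack.act' (f e) ^ 2 = 1 := by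
  have power := h.pow_eq_one e
  rwa [show (twistLink k).comp e = 0 from he] at power

theorem colorsAt_overEnd (h : LinkDiagram.IsColoring o ![2, 3] f) (z : Crossing k.natAbs) :
    LinkDiagram.ColorsAt o f z (overEnd k z) :=
  h.colorsAt z _ (isOver_overEnd k z)

theorem under_eq_act (h : LinkDiagram.IsColoring o ![2, 3] f) (z : Crossing k.natAbs)
    (hz : comp (ends z (overEnd k z)) = 0) :
    f (ends z (overEnd k z + 1)) = f (ends z (overEnd k z)) ◃ f (ends z (overEnd k z + 3)) :=
  ((LinkDiagram.colorsAt_iff_of_sq_eq_one (sq_act'_eq_one h hz)).1 (colorsAt_overEnd h z)).2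

theorem top_bot_eq (h : LinkDiagram.IsColoring o ![2, 3] f) (j : Fin (k.natAbs + 1)) :
    f (.top j) = dihedralSeq (f .topIn) (f .botIn) (-(k.sign * j)) ∧
      f (.bot j) = dihedralSeq (f .topIn) (f .botIn) (1 - k.sign * j) := by
  have act_eq := dihedralSeq_act_dihedralSeq (sq_act'_eq_one h (e := .topIn) rfl)
    (sq_act'_eq_one h (e := .botIn) rfl)
  induction j using Fin.induction with
  | zero =>
    simp only [Fin.val_zero, Nat.cast_zero, mul_zero, neg_zero, sub_zero]
    exact ⟨(colorsAt_overEnd h .topR).over_eq.symm, (colorsAt_overEnd h .botR).over_eq.symm⟩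
  | succ i ih =>
    rw [Fin.val_castSucc] at ih
    rw [Fin.val_succ]
    have hover := (colorsAt_overEnd h (.twist i)).over_eq
    have hunder := under_eq_act h (.twist i) (by rw [overEnd]; split_ifs <;> rfl)
    obtain hk | hk : 0 < k ∨ k < 0 := by have := i.pos; lia
    · rw [overEnd, if_pos hk] at hover hunder
      change f (.bot i.succ) = f (.top i.castSucc) at hover
      change f (.top i.succ) = f (.bot i.succ) ◃ f (.bot i.castSucc) at hunder
      rw [hunder, hover, ih.1, ih.2, act_eq, Int.sign_eq_one_of_pos hk]
      constructor <;> congr 1 <;> lia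
    · rw [overEnd, if_neg hk.not_gt] at hover hunder
      change f (.bot i.castSucc) = f (.top i.succ) at hover
      change f (.bot i.succ) = f (.bot i.castSucc) ◃ f (.top i.castSucc) at hunder
      rw [hunder, ← hover, ih.1, ih.2, act_eq, Int.sign_eq_neg_one_of_neg hk]
      constructor <;> congr 1 <;> lia

theorem eq_coloring (h : LinkDiagram.IsColoring o ![2, 3] f) :
    f = coloring k (f .topIn) (f .botIn) (f .cN)
      (Rack.act' (f .cN) ^ (o.sign (.topL, 3) : ℤ)) := by
  have hW : f .cN = f .cW := (colorsAt_overEnd h .topL).over_eq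
  have hS : f .cW = f .cS := (colorsAt_overEnd h .botL).over_eq
  have hb : f .b = (Rack.act' (f .cW) ^ (o.sign (.botL, 3) : ℤ)) (f .botIn) :=
    (colorsAt_overEnd h .botL).under_eq
  have ha : f .a = _ := (colorsAt_overEnd h .topL).under_eq
  have hR : f .a = f .claspR := (colorsAt_overEnd h .claspBot).over_eq
  have hL : f .claspL = f (.bot (Fin.last _)) := (colorsAt_overEnd h .claspTop).over_eq
  funext e
  cases e with
  | topIn | botIn | cN => rfl
  | cW => exact hW.symm
  | cS => exact (hW.trans hS).symm
  | cE => exact under_eq_act h .topR rfl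
  | a => exact ha
  | claspR => exact hR.symm.trans ha
  | b => exact hb.trans (by rw [sign_botL, ← hW]; rfl)
  | claspL =>
    rw [hL, (top_bot_eq h _).2, Fin.val_last, Int.sign_mul_natAbs, coloring]
  | top j => exact (top_bot_eq h j).1
  | bot j => exact (top_bot_eq h j).2

theorem twistRelations_of_isColoring (h : LinkDiagram.IsColoring o ![2, 3] f) :
    TwistRelations k (f .topIn) (f .botIn) (f .cN)
      (Rack.act' (f .cN) ^ (o.sign (.topL, 3) : ℤ)) where
  sq_top := sq_act'_eq_one h rfl
  sq_bot := sq_act'_eq_one h rfl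
  cube_circle := h.pow_eq_one .cN
  exists_sign := ⟨_, rfl⟩
  circle := by
    have hunder : f .cS = f .botIn ◃ f .cE := under_eq_act h .botR rfl
    rw [eq_coloring h] at hunder
    exact hunder.symm
  clasp_top := by
    have hunder : f .claspR = f .claspL ◃ f .b := under_eq_act h .claspTop rfl
    rw [eq_coloring h] at hunder
    exact hunder
  clasp_bot := by
    have hunder : f (.top (Fin.last _)) = f .a ◃ f .claspL := under_eq_act h .claspBot rfl
    rw [eq_coloring h, coloring_top_last] at hunder
    exact hunder

theorem act'_coloring_mem_closure (h : TwistRelations k x y c Z) (e : Edge k.natAbs) :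
    Rack.act' (coloring k x y c Z e) ∈
      Subgroup.closure {Rack.act' x, Rack.act' y, Z} := by
  set H := Subgroup.closure {Rack.act' x, Rack.act' y, Z}
  have hx : Rack.act' x ∈ H := Subgroup.subset_closure (.inl rfl)
  have hy : Rack.act' y ∈ H := Subgroup.subset_closure (.inr (.inl rfl))
  have hZ : Z ∈ H := Subgroup.subset_closure (.inr (.inr rfl))
  have hc : Rack.act' c ∈ H := by
    obtain ⟨ε, hε⟩ := h.act'_circle
    exact hε ▸ zpow_mem hZ _
  have conj : ∀ {p}, p ∈ innerGroup Q → p ∈ H → ∀ {z}, Rack.act' z ∈ H → Rack.act' (p z) ∈ H :=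
    fun hp hpH _ hz => act'_apply_of_mem_innerGroup hp _ ▸ mul_mem (mul_mem hpH hz) (inv_mem hpH)
  have seq : ∀ i, Rack.act' (dihedralSeq x y i) ∈ H := fun i =>
    act'_dihedralSeq h.sq_top h.sq_bot i ▸ mul_mem (zpow_mem (mul_mem hy hx) i) hx
  cases e with
  | topIn => exact hx
  | botIn => exact hy
  | a | claspR => exact conj h.mem_innerGroup hZ hx
  | b => exact conj h.mem_innerGroup hZ hy
  | cN | cW | cS => exact hc
  | cE => exact conj (act'_mem_innerGroup x) hx hc
  | claspL | top j | bot j => exact seq _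

end TwistLink

/-! ### Conjugation representations -/

section Conj

variable {G : Type*} [Group G]

theorem act'_conj_zpow (g : Quandle.Conj G) (n : ℤ) : Rack.act' g ^ n = Rack.act' (g ^ n) := by
  have act'_eq (g : G) : Rack.act' (R := Quandle.Conj G) g = MulAut.toPerm G (MulAut.conj g) := rfl
  rw [act'_eq, act'_eq, ← map_zpow, ← map_zpow]

theorem act'_conj_eq_one {g : Quandle.Conj G} (hg : g ∈ Subgroup.center G) : Rack.act' g = 1 := by
  ext x
  change g * x * g⁻¹ = x
  rw [← Subgroup.mem_center_iff.1 hg x, mul_inv_cancel_right]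

end Conj

section TwistRepresentation

variable {G : Type*} [Group G] {k : ℤ} {u : ℤ → G} {g : G}

/-- A solution of the relations `TwistRelations` in the conjugation quandle of a group: `u` is the
sequence of the images of the arcs of the half-twists, and `g` or `g⁻¹`, depending on the
orientation, the image of the circle. -/
structure TwistRepresentation (k : ℤ) (u : ℤ → G) (g : G) : Prop where
  conj_eq (i j) : u i * u j * (u i)⁻¹ = u (2 * i - j)
  sq_mem_center (i) : u i ^ 2 ∈ Subgroup.center G
  cube_eq_one : g ^ 3 = 1
  circle : Commute (u 1 * u 0) g
  clasp_top : g * u 0 * g⁻¹ = u (1 - k) * (g * u 1 * g⁻¹) * (u (1 - k))⁻¹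
  clasp_bot : u (-k) = g * u 0 * g⁻¹ * u (1 - k) * (g * u 0 * g⁻¹)⁻¹

/-- The element by which the product of symmetries in `circleElement` conjugates. -/
def circleConjugator (u : ℤ → G) (g : G) (v : Fin 2 × Fin 2 × Fin 2) : G :=
  u 0 ^ v.1.val * (g * u 0 * g⁻¹) ^ v.2.1.val * (g⁻¹ * u 0 * g) ^ v.2.2.val

namespace TwistRepresentation

theorem dihedralSeq_eq (h : TwistRepresentation k u g) (i : ℤ) :
    dihedralSeq (Q := Quandle.Conj G) (u 0) (u 1) i = u i :=
  dihedralSeq_eq_of_act_eq (Q := Quandle.Conj G) h.conj_eq i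

theorem twistRelations (h : TwistRepresentation k u g) (ε : ℤˣ) :
    TwistRelations (Q := Quandle.Conj G) k (u 0) (u 1) (g ^ (ε : ℤ))
      (Rack.act' (R := Quandle.Conj G) g) where
  sq_top := by
    rw [← zpow_natCast, act'_conj_zpow, zpow_natCast, act'_conj_eq_one (h.sq_mem_center 0)]
  sq_bot := by
    rw [← zpow_natCast, act'_conj_zpow, zpow_natCast, act'_conj_eq_one (h.sq_mem_center 1)]
  cube_circle := by
    rw [← act'_conj_zpow, ← zpow_natCast, zpow_comm, act'_conj_zpow, zpow_natCast, h.cube_eq_one,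
      act'_conj_eq_one (one_mem _), one_zpow]
  exists_sign := ⟨ε, by
    rw [← act'_conj_zpow, ← zpow_mul, Int.units_coe_mul_self, zpow_one]⟩
  circle := by
    change u 1 * (u 0 * g ^ (ε : ℤ) * (u 0)⁻¹) * (u 1)⁻¹ = g ^ (ε : ℤ)
    simpa only [mul_assoc, mul_inv_rev] using (h.circle.zpow_right ε).mul_inv_cancel
  clasp_top := by
    rw [h.dihedralSeq_eq]
    exact h.clasp_top
  clasp_bot := by
    rw [h.dihedralSeq_eq, h.dihedralSeq_eq]
    exact h.clasp_bot

theorem knotElement_eq (h : TwistRepresentation k u g) (v : ℤ × ℤ) :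
    knotElement (Q := Quandle.Conj G) (u 0) (u 1) (Rack.act' (R := Quandle.Conj G) g) v =
      g ^ v.1 * u v.2 * (g ^ v.1)⁻¹ := by
  rw [knotElement, h.dihedralSeq_eq, act'_conj_zpow]
  rfl

end TwistRepresentation

theorem circleElement_conj_eq (u : ℤ → G) (g c : G) (v : Fin 2 × Fin 2 × Fin 2) :
    circleElement (Q := Quandle.Conj G) (u 0) c (Rack.act' (R := Quandle.Conj G) g) v =
      circleConjugator u g v * c * (circleConjugator u g v)⁻¹ := by
  have inv_eq : (Rack.act' (R := Quandle.Conj G) g)⁻¹ = Rack.act' (R := Quandle.Conj G) g⁻¹ := by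
    rw [← zpow_neg_one, act'_conj_zpow, zpow_neg_one]
  have act'_pow (z : G) (n : ℕ) : Rack.act' (R := Quandle.Conj G) z ^ n =
      Rack.act' (R := Quandle.Conj G) (z ^ n) := by
    rw [← zpow_natCast, act'_conj_zpow, zpow_natCast]
  have apply_eq (z w : G) : Rack.act' (R := Quandle.Conj G) z w = z * w * z⁻¹ := rfl
  simp only [circleElement, circleConjugator, inv_eq, act'_pow, apply_eq, Equiv.Perm.mul_apply,
    inv_inv, mul_inv_rev, mul_assoc]

end TwistRepresentation

section Matrices

/-- An element of order `4` of `SL(2, 3)`. -/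
def quarterTurn : Matrix.SpecialLinearGroup (Fin 2) (ZMod 3) :=
  ⟨!![0, 1; 2, 0], by decide⟩

/-- An element of order `3` of `SL(2, 3)`. -/
def shear : Matrix.SpecialLinearGroup (Fin 2) (ZMod 3) :=
  ⟨!![1, 1; 0, 1], by decide⟩

theorem quarterTurn_zpow_eq_zpow {a b : ℤ} (h : a ≡ b [ZMOD 4]) :
    quarterTurn ^ a = quarterTurn ^ b := by
  have pow_four : quarterTurn ^ 4 = 1 := by decide
  rw [zpow_eq_zpow_emod' a pow_four, zpow_eq_zpow_emod' b pow_four]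
  exact congrArg (quarterTurn ^ ·) h

theorem quarterTurn_zpow_eq_or (k : ℤ) :
    quarterTurn ^ (1 + 2 * (1 - k)) = quarterTurn ^ (3 : ℤ) ∧
        quarterTurn ^ (1 + 2 * -k) = quarterTurn ^ (1 : ℤ) ∨
      quarterTurn ^ (1 + 2 * (1 - k)) = quarterTurn ^ (1 : ℤ) ∧
        quarterTurn ^ (1 + 2 * -k) = quarterTurn ^ (3 : ℤ) := by
  obtain ⟨i, rfl | rfl⟩ := Int.even_or_odd' k
  · exact .inl ⟨quarterTurn_zpow_eq_zpow (by rw [Int.ModEq]; lia),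
      quarterTurn_zpow_eq_zpow (by rw [Int.ModEq]; lia)⟩
  · exact .inr ⟨quarterTurn_zpow_eq_zpow (by rw [Int.ModEq]; lia),
      quarterTurn_zpow_eq_zpow (by rw [Int.ModEq]; lia)⟩

theorem twistRepresentation_matrices (k : ℤ) :
    TwistRepresentation k (fun i => quarterTurn ^ (1 + 2 * i)) shear where
  conj_eq i j := by
    rw [← zpow_neg, ← zpow_add, ← zpow_add]
    exact quarterTurn_zpow_eq_zpow (by rw [Int.ModEq]; lia)
  sq_mem_center i := by
    have sq_comm : ∀ a, a * quarterTurn ^ 2 = quarterTurn ^ 2 * a := by decide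
    have sq_eq : (quarterTurn ^ (1 + 2 * i)) ^ 2 = quarterTurn ^ 2 := by
      rw [← zpow_natCast, ← zpow_mul, ← zpow_natCast quarterTurn]
      exact quarterTurn_zpow_eq_zpow (by rw [Int.ModEq]; lia)
    rw [sq_eq]
    exact Subgroup.mem_center_iff.2 sq_comm
  cube_eq_one := by decide
  circle := by change _ * _ = _ * _; decide
  clasp_top := by
    obtain ⟨h₁, -⟩ | ⟨h₁, -⟩ := quarterTurn_zpow_eq_or k <;> rw [h₁] <;> decide
  clasp_bot := by
    obtain ⟨h₁, h₂⟩ | ⟨h₁, h₂⟩ := quarterTurn_zpow_eq_or k <;> rw [h₁, h₂] <;> decide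

theorem modEq_of_shear_conj_quarterTurn_eq {i j s t : ℤ}
    (h : shear ^ i * quarterTurn ^ (1 + 2 * s) * (shear ^ i)⁻¹ =
      shear ^ j * quarterTurn ^ (1 + 2 * t) * (shear ^ j)⁻¹) :
    i ≡ j [ZMOD 3] ∧ s ≡ t [ZMOD 2] := by
  have key : ∀ (i j : Fin 3) (s t : Fin 2),
      shear ^ i.val * quarterTurn ^ (1 + 2 * s.val) * (shear ^ i.val)⁻¹ =
        shear ^ j.val * quarterTurn ^ (1 + 2 * t.val) * (shear ^ j.val)⁻¹ → i = j ∧ s = t := by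
    decide
  have shear_zpow : ∀ i : ℤ, ∃ a : Fin 3, i ≡ a [ZMOD 3] ∧ shear ^ i = shear ^ a.val := fun i => by
    refine ⟨⟨(i % 3).toNat, by lia⟩, by change _ = ((i % 3).toNat : ℤ) % 3; lia, ?_⟩
    rw [zpow_eq_zpow_emod' i (show shear ^ 3 = 1 by decide), ← zpow_natCast]
    exact congrArg (shear ^ ·) (Int.toNat_of_nonneg (Int.emod_nonneg i three_ne_zero)).symm
  have quarterTurn_zpow : ∀ s : ℤ, ∃ a : Fin 2, s ≡ a [ZMOD 2] ∧
      quarterTurn ^ (1 + 2 * s) = quarterTurn ^ (1 + 2 * a.val) := fun s => by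
    refine ⟨⟨(s % 2).toNat, by lia⟩, by change _ = ((s % 2).toNat : ℤ) % 2; lia, ?_⟩
    rw [← zpow_natCast]
    exact quarterTurn_zpow_eq_zpow (by
      change _ = ((1 + 2 * (s % 2).toNat : ℕ) : ℤ) % 4
      lia)
  obtain ⟨i', hi, hi'⟩ := shear_zpow i
  obtain ⟨j', hj, hj'⟩ := shear_zpow j
  obtain ⟨s', hs, hs'⟩ := quarterTurn_zpow s
  obtain ⟨t', ht, ht'⟩ := quarterTurn_zpow t
  rw [hi', hj', hs', ht'] at h
  obtain ⟨rfl, rfl⟩ := key _ _ _ _ h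
  exact ⟨hi.trans hj.symm, hs.trans ht.symm⟩

theorem eq_of_circleConjugator_matrices_eq (ε : ℤˣ) {v w : Fin 2 × Fin 2 × Fin 2}
    (h : circleConjugator (fun i => quarterTurn ^ (1 + 2 * i)) shear v * shear ^ (ε : ℤ) *
        (circleConjugator (fun i => quarterTurn ^ (1 + 2 * i)) shear v)⁻¹ =
      circleConjugator (fun i => quarterTurn ^ (1 + 2 * i)) shear w * shear ^ (ε : ℤ) *
        (circleConjugator (fun i => quarterTurn ^ (1 + 2 * i)) shear w)⁻¹)
    (hparity : v.1.val + v.2.1.val + v.2.2.val ≡ w.1.val + w.2.1.val + w.2.2.val [MOD 2]) :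
    v = w := by
  obtain rfl | rfl := Int.units_eq_one_or ε <;> revert v w <;> decide

end Matrices

section Dihedral

open DihedralGroup

/-- The class of `2 * k - 1`, an element of order `3`. -/
def twistClass (k : ℤ) : ZMod (3 * (2 * k - 1).natAbs) :=
  2 * k - 1

theorem intCast_mul_twistClass_eq_zero_iff (k n : ℤ) :
    (n : ZMod (3 * (2 * k - 1).natAbs)) * twistClass k = 0 ↔ 3 ∣ n := by
  have cast_eq : (n : ZMod (3 * (2 * k - 1).natAbs)) * twistClass k = (n * (2 * k - 1) : ℤ) := by
    rw [twistClass]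
    push_cast
    rfl
  have dvd_iff : 3 * |2 * k - 1| ∣ n * (2 * k - 1) ↔ 3 * (2 * k - 1) ∣ n * (2 * k - 1) := by
    rw [← abs_dvd, abs_mul, abs_abs, ← abs_mul, abs_dvd]
  rw [cast_eq, ZMod.intCast_zmod_eq_zero_iff_dvd, Nat.cast_mul, Int.natCast_natAbs, Nat.cast_ofNat,
    dvd_iff, mul_dvd_mul_iff_right (by lia)]

theorem twistRepresentation_dihedral (k : ℤ) :
    TwistRepresentation k (fun i => (sr i : DihedralGroup (3 * (2 * k - 1).natAbs)))
      (r (twistClass k)) := by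
  have three_mul : 3 * twistClass k = 0 := by
    exact_mod_cast (intCast_mul_twistClass_eq_zero_iff k 3).2 dvd_rfl
  rw [twistClass] at three_mul
  refine ⟨fun i j => ?_, fun i => ?_, ?_, ?_, ?_, ?_⟩
  · simp only [sr_mul_sr, inv_sr, r_mul_sr, Int.cast_sub, Int.cast_mul, Int.cast_ofNat]
    congr 1
    ring
  · rw [sq, sr_mul_self]
    exact one_mem _
  · rw [r_pow, ← r_zero]
    exact congrArg r ((mul_comm _ _).trans three_mul)
  · rw [sr_mul_sr]
    exact congrArg r (add_comm _ _)
  · simp only [sr_mul_sr, inv_sr, r_mul_sr, sr_mul_r, inv_r, twistClass]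
    push_cast
    congr 1
    linear_combination -three_mul
  · simp only [sr_mul_sr, inv_sr, r_mul_sr, sr_mul_r, inv_r, twistClass]
    push_cast
    congr 1
    linear_combination three_mul

theorem circleConjugator_dihedral_conj_r {n : ℕ} (z t : ZMod n) (v : Fin 2 × Fin 2 × Fin 2) :
    circleConjugator (fun i => (sr i : DihedralGroup n)) (r z) v * r t *
        (circleConjugator (fun i => (sr i : DihedralGroup n)) (r z) v)⁻¹ =
      r ((-1) ^ (v.1.val + v.2.1.val + v.2.2.val) * t) := by
  have conj_pow (i t : ZMod n) (m : ℕ) : sr i ^ m * r t * (sr i ^ m)⁻¹ = r ((-1) ^ m * t) := by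
    induction m with
    | zero => simp
    | succ m ih =>
      have sr_conj (t : ZMod n) : sr i * r t * (sr i)⁻¹ = r (-t) := by simp
      rw [pow_succ', mul_inv_rev, mul_assoc, mul_assoc, ← mul_assoc (r t), ← mul_assoc (sr i ^ m),
        ← mul_assoc, ← mul_assoc (sr i ^ m), ih, sr_conj, pow_succ', neg_one_mul, neg_mul]
  have conj_mul (a b c d : DihedralGroup n) :
      a * b * c * d * (a * b * c)⁻¹ = a * (b * (c * d * c⁻¹) * b⁻¹) * a⁻¹ := by
    group
  simp only [circleConjugator, Int.cast_zero, inv_r, r_mul_sr, sr_mul_r, conj_mul, conj_pow]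
  rw [pow_add, pow_add, mul_assoc, mul_assoc]

theorem modEq_two_of_circleConjugator_dihedral_eq {n : ℕ} {z t : ZMod n} (ht : 2 * t ≠ 0)
    {v w : Fin 2 × Fin 2 × Fin 2}
    (h : circleConjugator (fun i => (sr i : DihedralGroup n)) (r z) v * r t *
        (circleConjugator (fun i => (sr i : DihedralGroup n)) (r z) v)⁻¹ =
      circleConjugator (fun i => (sr i : DihedralGroup n)) (r z) w * r t *
        (circleConjugator (fun i => (sr i : DihedralGroup n)) (r z) w)⁻¹) :
    v.1.val + v.2.1.val + v.2.2.val ≡ w.1.val + w.2.1.val + w.2.2.val [MOD 2] := by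
  rw [circleConjugator_dihedral_conj_r, circleConjugator_dihedral_conj_r, r.injEq] at h
  have ne_neg : t ≠ -t := fun ht' => ht (by rw [two_mul, ← eq_neg_iff_add_eq_zero, ← ht'])
  generalize v.1.val + v.2.1.val + v.2.2.val = a at *
  generalize w.1.val + w.2.1.val + w.2.2.val = b at *
  obtain ha | ha := a.even_or_odd <;> obtain hb | hb := b.even_or_odd
  · exact (Nat.even_iff.1 ha).trans (Nat.even_iff.1 hb).symm
  · rw [ha.neg_one_pow, hb.neg_one_pow, one_mul, neg_one_mul] at h
    exact absurd h ne_neg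
  · rw [ha.neg_one_pow, hb.neg_one_pow, one_mul, neg_one_mul] at h
    exact absurd h.symm ne_neg
  · exact (Nat.odd_iff.1 ha).trans (Nat.odd_iff.1 hb).symm

end Dihedral

/-! ### The two components -/

namespace TwistLink

section Components

variable {k : ℤ} (o : (twistLink k).Orientation)

/-- The effect on the arcs of the twist knot of passing under the circle. -/
def underCircle : Equiv.Perm ((twistLink k).NQuandle o ![2, 3]) :=
  Rack.act' ((twistLink k).arc o ![2, 3] .cN) ^ (o.sign (.topL, 3) : ℤ)

/-- The elements of the component of the twist knot, with repetitions. -/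
def knotArc : ℤ × ℤ → (twistLink k).NQuandle o ![2, 3] :=
  knotElement ((twistLink k).arc o ![2, 3] .topIn) ((twistLink k).arc o ![2, 3] .botIn)
    (underCircle o)

/-- The elements of the component of the circle. -/
def circleArc : Fin 2 × Fin 2 × Fin 2 → (twistLink k).NQuandle o ![2, 3] :=
  circleElement ((twistLink k).arc o ![2, 3] .topIn) ((twistLink k).arc o ![2, 3] .cN)
    (underCircle o)

theorem twistRelations_arc : TwistRelations k ((twistLink k).arc o ![2, 3] .topIn)
    ((twistLink k).arc o ![2, 3] .botIn) ((twistLink k).arc o ![2, 3] .cN) (underCircle o) :=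
  twistRelations_of_isColoring (LinkDiagram.isColoring_arc o ![2, 3])

theorem arc_eq_coloring : (twistLink k).arc o ![2, 3] =
    coloring k ((twistLink k).arc o ![2, 3] .topIn) ((twistLink k).arc o ![2, 3] .botIn)
      ((twistLink k).arc o ![2, 3] .cN) (underCircle o) :=
  eq_coloring (LinkDiagram.isColoring_arc o ![2, 3])

theorem innerGroup_le_closure : innerGroup ((twistLink k).NQuandle o ![2, 3]) ≤
    Subgroup.closure {Rack.act' ((twistLink k).arc o ![2, 3] .topIn),
      Rack.act' ((twistLink k).arc o ![2, 3] .botIn), underCircle o} :=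
  PresentedQuandle.innerGroup_le fun e => by
    have mem := act'_coloring_mem_closure (twistRelations_arc o) e
    rwa [← arc_eq_coloring] at mem

theorem arc_mem_range_knotArc {e : Edge k.natAbs} (he : comp e = 0) :
    (twistLink k).arc o ![2, 3] e ∈ Set.range (knotArc o) := by
  rw [arc_eq_coloring]
  cases e with
  | topIn => exact ⟨(0, 0), rfl⟩
  | botIn => exact ⟨(0, 1), rfl⟩
  | a | claspR => exact ⟨(1, 0), rfl⟩
  | b => exact ⟨(1, 1), rfl⟩
  | claspL => exact ⟨(0, 1 - k), rfl⟩
  | top j => exact ⟨(0, -(k.sign * j)), rfl⟩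
  | bot j => exact ⟨(0, 1 - k.sign * j), rfl⟩
  | _ => simp [comp] at he

theorem arc_mem_range_circleArc {e : Edge k.natAbs} (he : comp e = 1) :
    (twistLink k).arc o ![2, 3] e ∈ Set.range (circleArc o) := by
  rw [arc_eq_coloring]
  cases e with
  | cN | cW | cS => exact ⟨(0, 0, 0), rfl⟩
  | cE => exact ⟨(1, 0, 0), rfl⟩
  | _ => simp [comp] at he

theorem quandleComponent_arc_of_comp_eq_zero {e : Edge k.natAbs} (he : comp e = 0) :
    quandleComponent ((twistLink k).arc o ![2, 3] e) = Set.range (knotArc o) := by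
  have range_eq := ((twistRelations_arc o).quandleComponent_eq (innerGroup_le_closure o)).1
  have mem := arc_mem_range_knotArc o he
  rw [knotArc, ← range_eq] at mem ⊢
  exact quandleComponent_eq_of_mem mem

theorem quandleComponent_arc_of_comp_eq_one {e : Edge k.natAbs} (he : comp e = 1) :
    quandleComponent ((twistLink k).arc o ![2, 3] e) = Set.range (circleArc o) := by
  have range_eq := ((twistRelations_arc o).quandleComponent_eq (innerGroup_le_closure o)).2
  have mem := arc_mem_range_circleArc o he
  rw [circleArc, ← range_eq] at mem ⊢
  exact quandleComponent_eq_of_mem mem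

theorem range_knotArc_union_range_circleArc :
    Set.range (knotArc o) ∪ Set.range (circleArc o) = Set.univ := by
  refine Set.eq_univ_of_forall fun z => ?_
  obtain ⟨e, he⟩ := PresentedQuandle.exists_mem_quandleComponent_of z
  obtain h | h : comp e = 0 ∨ comp e = 1 := by lia
  · exact .inl (quandleComponent_arc_of_comp_eq_zero o h ▸ he)
  · exact .inr (quandleComponent_arc_of_comp_eq_one o h ▸ he)

end Components

section Separation

variable {k : ℤ} (o : (twistLink k).Orientation)

theorem exists_hom_of_twistRepresentation {G : Type} [Group G] {u : ℤ → G} {g : G}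
    (h : TwistRepresentation k u g) :
    ∃ φ : (twistLink k).NQuandle o ![2, 3] →◃ Quandle.Conj G,
      (∀ v, φ (knotArc o v) = g ^ v.1 * u v.2 * (g ^ v.1)⁻¹) ∧
      ∀ v, φ (circleArc o v) = circleConjugator u g v * g ^ (o.sign (.topL, 3) : ℤ) *
        (circleConjugator u g v)⁻¹ := by
  have relations := h.twistRelations (o.sign (.topL, 3))
  have act'_eq : Rack.act' (R := Quandle.Conj G) g =
      Rack.act' (R := Quandle.Conj G) (g ^ (o.sign (.topL, 3) : ℤ)) ^ (o.sign (.topL, 3) : ℤ) := by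
    rw [← act'_conj_zpow, ← zpow_mul, Int.units_coe_mul_self, zpow_one]
  let φ := (isColoring_coloring act'_eq relations).lift
  have semiconj : Function.Semiconj φ (underCircle o) (Rack.act' (R := Quandle.Conj G) g) := by
    rw [act'_eq]
    exact semiconj_zpow (semiconj_act' φ _) _
  exact ⟨φ, fun v => (map_knotElement φ semiconj v).trans (h.knotElement_eq v),
    fun v => (map_circleElement φ semiconj v).trans (circleElement_conj_eq u g _ v)⟩

theorem knotArc_eq_knotArc_iff (v w : ℤ × ℤ) :
    knotArc o v = knotArc o w ↔ v.1 ≡ w.1 [ZMOD 3] ∧ v.2 ≡ w.2 [ZMOD 6 * (2 * k - 1)] := by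
  refine ⟨fun h => ?_, fun h => (twistRelations_arc o).knotElement_eq_of_modEq h.1 h.2⟩
  obtain ⟨φ, hφ, -⟩ := exists_hom_of_twistRepresentation o (twistRepresentation_matrices k)
  obtain ⟨ψ, hψ, -⟩ := exists_hom_of_twistRepresentation o (twistRepresentation_dihedral k)
  have matrices_eq := congrArg φ h
  rw [hφ, hφ] at matrices_eq
  obtain ⟨modEq_three, modEq_two⟩ := modEq_of_shear_conj_quarterTurn_eq matrices_eq
  have dihedral_eq := congrArg ψ h
  rw [knotArc, (twistRelations_arc o).knotElement_eq_of_modEq (w := (w.1, v.2)) modEq_three rfl,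
    ← knotArc, hψ, hψ] at dihedral_eq
  have modEq_odd : v.2 ≡ w.2 [ZMOD 3 * (2 * k - 1)] := by
    have cast_eq := DihedralGroup.sr.inj (mul_left_cancel (mul_right_cancel dihedral_eq))
    rw [ZMod.intCast_eq_intCast_iff] at cast_eq
    rw [Int.modEq_iff_dvd] at cast_eq ⊢
    rwa [Nat.cast_mul, Int.natCast_natAbs, ← abs_of_nonneg (a := ((3 : ℕ) : ℤ)) (by simp),
      ← abs_mul, abs_dvd] at cast_eq
  refine ⟨modEq_three, ?_⟩
  have coprime : IsCoprime (2 : ℤ) (3 * (2 * k - 1)) := ⟨2 - 3 * k, 1, by ring⟩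
  rw [show 6 * (2 * k - 1) = 2 * (3 * (2 * k - 1)) by ring]
  exact Int.modEq_iff_dvd.2 (coprime.mul_dvd modEq_two.dvd modEq_odd.dvd)

theorem circleArc_injective : Function.Injective (circleArc o) := fun v w h => by
  obtain ⟨φ, -, hφ⟩ := exists_hom_of_twistRepresentation o (twistRepresentation_matrices k)
  obtain ⟨ψ, -, hψ⟩ := exists_hom_of_twistRepresentation o (twistRepresentation_dihedral k)
  have matrices_eq := congrArg φ h
  have dihedral_eq := congrArg ψ h
  rw [hφ, hφ] at matrices_eq
  rw [hψ, hψ, DihedralGroup.r_zpow] at dihedral_eq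
  have two_mul_ne_zero : 2 * (twistClass k * (o.sign (.topL, 3) : ℤ)) ≠ 0 := by
    have ne_zero := (intCast_mul_twistClass_eq_zero_iff k (2 * o.sign (.topL, 3))).not.2 <| by
      obtain sign_eq | sign_eq := Int.units_eq_one_or (o.sign (.topL, 3)) <;> rw [sign_eq] <;>
        decide
    rwa [Int.cast_mul, Int.cast_ofNat, mul_assoc, mul_comm _ (twistClass k)] at ne_zero
  exact eq_of_circleConjugator_matrices_eq _ matrices_eq
    (modEq_two_of_circleConjugator_dihedral_eq two_mul_ne_zero dihedral_eq)

theorem disjoint_range_knotArc_range_circleArc :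
    Disjoint (Set.range (knotArc o)) (Set.range (circleArc o)) := by
  obtain ⟨ψ, hψ, hψ'⟩ := exists_hom_of_twistRepresentation o (twistRepresentation_dihedral k)
  rw [Set.disjoint_range_iff]
  intro v w h
  have dihedral_eq := congrArg ψ h
  rw [hψ, hψ', DihedralGroup.r_zpow, DihedralGroup.r_zpow,
    circleConjugator_dihedral_conj_r] at dihedral_eq
  simp at dihedral_eq

theorem natCard_range_knotArc :
    (Nat.card (Set.range (knotArc o)) : ℤ) = 18 * |2 * k - 1| := by
  let residue : ℤ × ℤ → ZMod 3 × ZMod (6 * (2 * k - 1)).natAbs := Prod.map Int.cast Int.cast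
  have residue_surjective : Function.Surjective residue :=
    ZMod.intCast_surjective.prodMap ZMod.intCast_surjective
  have eq_iff : ∀ v w, knotArc o v = knotArc o w ↔ residue v = residue w := fun v w => by
    rw [knotArc_eq_knotArc_iff, Prod.ext_iff]
    simp only [residue, Prod.map_fst, Prod.map_snd, ZMod.intCast_eq_intCast_iff,
      Int.modEq_iff_dvd, Int.natCast_natAbs, abs_dvd, Nat.cast_ofNat]
  rw [natCard_range_eq_of_apply_eq_iff eq_iff, residue_surjective.range_eq,
    Nat.card_univ, Nat.card_prod, Nat.card_zmod, Nat.card_zmod, Int.natAbs_mul, Nat.cast_mul,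
    Nat.cast_mul, Int.natCast_natAbs, Int.natCast_natAbs, ← mul_assoc]
  rfl

theorem natCard_range_circleArc : Nat.card (Set.range (circleArc o)) = 8 := by
  rw [Nat.card_range_of_injective (circleArc_injective o)]
  simp

theorem finite_range_knotArc : (Set.range (knotArc o)).Finite := by
  have card_eq := natCard_range_knotArc o
  have pos : 0 < |2 * k - 1| := abs_pos.2 (by lia)
  exact Nat.finite_of_card_ne_zero fun h => by rw [h] at card_eq; lia

end Separation

end TwistLink

theorem theorem2 (k : ℤ) (o : (twistLink k).Orientation) :
    (Nat.card ((twistLink k).NQuandle o ![2, 3]) : ℤ) = 18 * |2 * k - 1| + 8 ∧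
    (∀ e, (twistLink k).comp e = 0 →
      (Nat.card (quandleComponent ((twistLink k).arc o ![2, 3] e)) : ℤ) = 18 * |2 * k - 1|) ∧
    (∀ e, (twistLink k).comp e = 1 →
      Nat.card (quandleComponent ((twistLink k).arc o ![2, 3] e)) = 8) := by
  have card_knot := TwistLink.natCard_range_knotArc o
  have card_circle := TwistLink.natCard_range_circleArc o
  refine ⟨?_, fun e he => ?_, fun e he => ?_⟩
  · rw [Nat.card_coe_set_eq] at card_knot card_circle
    rw [← Set.ncard_univ, ← TwistLink.range_knotArc_union_range_circleArc o,
      Set.ncard_union_eq (TwistLink.disjoint_range_knotArc_range_circleArc o)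
        (TwistLink.finite_range_knotArc o) (Set.finite_range _), Nat.cast_add, card_knot,
      card_circle, Nat.cast_ofNat]
  · rw [TwistLink.quandleComponent_arc_of_comp_eq_zero o he, card_knot]
  · rw [TwistLink.quandleComponent_arc_of_comp_eq_one o he, card_circle]
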